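/- **Theorem 6.3.** Conventions. A parameterized promise problem consists of instances $x$ with a parameter $k=k(x)\in\mathbb N$ and disjoint sets of YES and NO instances. An FPT algorithm for it is a deterministic algorithm that runs on every instance in time $f(k)\cdot|x|^{c}$, for some computable function $f$ and constant $c$, and outputs $1$ on every YES instance and $0$ on every NO instance; a randomized FPT algorithm may toss fair coins, obeys the same time bound on every outcome of the coins, and outputs $1$ with probability at least $2/3$ on every YES instance and $0$ with probability at least $2/3$ on every NO instance. Numbers in the lattice instances below are encoded in binary. A 2CSP instance $\Gamma$ consists of a finite simple undirected graph $G=(V,E)$ with $E\neq\emptyset$, a finite nonempty alphabet $\Sigma$, and a constraint $C_{uv}\subseteq\Sigma\times\Sigma$ for each edge $(u,v)\in E$; its value $\mathrm{val}(\Gamma)$ is the maximum over all $\psi:V\to\Sigma$ of the fraction of edges $(u,v)\in E$ with $(\psi(u),\psi(v))\in C_{uv}$. The Parameterized Inapproximability Hypothesis (PIH) states that there is an $\varepsilon>0$ such that no randomized FPT algorithm, with parameter $|V|$, distinguishes $\mathrm{val}(\Gamma)=1$ (YES) from $\mathrm{val}(\Gamma)<1-\varepsilon$ (NO). Statement. Assume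 PIH. Then for all real numbers $\gamma,p\ge 1$ there is no FPT algorithm, and also no randomized FPT algorithm, with parameter $t$, which on input $(\mathbf B,\mathbf y,t)$, where $\mathbf B\in\mathbb Z^{n\times q}$, $\mathbf y\in\mathbb Z^{n}$ and $n,q,t$ are positive integers, distinguishes between * (YES) there exists $\mathbf x\in\mathbb Z^{q}$ such that $\mathbf B\mathbf x-\mathbf y\in\{0,1\}^{n}$ and $\|\mathbf B\mathbf x-\mathbf y\|_p^p\le t$; * (NO) for all $\mathbf x\in\mathbb Z^{q}$ and all $w\in\mathbb Z\setminus\{0\}$, $\|\mathbf B\mathbf x-w\cdot\mathbf y\|_p^p>\gamma\cdot t$. -/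

import Mathlib

noncomputable section

namespace ParamComplexity

/-! ### Machine model: programs over binary trees with a unit cost per elementary step -/

/-- Data values: binary trees (S-expressions over the single atom `nil`). -/
inductive Val : Type
  | nil : Val
  | cons : Val → Val → Val

namespace Val

/-- The length `|x|` of an input: the number of nodes of the tree. -/
def size : Val → ℕ
  | nil => 1
  | cons a b => size a + size b + 1

def car : Val → Val
  | nil => nil
  | cons a _ => a

def cdr : Val → Val
  | nil => nil
  | cons _ b => b

/-- The bit `1` is `(nil . nil)`, the bit `0` is `nil`. -/
def ofBool : Bool → Val
  | true => cons nil nil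
  | false => nil

def ofList : List Val → Val
  | [] => nil
  | a :: l => cons a (ofList l)

/-- A natural number in binary, least significant bit first. -/
def binary (n : ℕ) : Val := ofList (n.bits.map ofBool)

/-- A natural number in unary. -/
def unary (n : ℕ) : Val := ofList (List.replicate n nil)

/-- An integer: a sign bit and the absolute value in binary. -/
def ofInt (z : ℤ) : Val := cons (ofBool (decide (z < 0))) (binary z.natAbs)

end Val

/-- Structured programs acting on one tree-valued register. This is a one-variable WHILE language
over S-expressions, extended by a fair coin. Every elementary step is a constant number of pointer
operations on a heap (copying a value copies a pointer), so that running times agree with those of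
(probabilistic) Turing machines up to a polynomial. -/
inductive Prog : Type
  /-- leave the register unchanged -/
  | skip : Prog
  /-- store `nil` -/
  | nil : Prog
  /-- replace the register by its left component -/
  | car : Prog
  /-- replace the register by its right component -/
  | cdr : Prog
  /-- replace the register by the outcome of a fresh fair coin toss -/
  | flip : Prog
  /-- run both programs on the present value and store the pair of the two results -/
  | pair : Prog → Prog → Prog
  /-- run one program after the other -/
  | seq : Prog → Prog → Prog
  /-- `ite c P Q`: run the test `c` on a copy of the register; run `P` if its result is not `nil`,
  and `Q` otherwise -/
  | ite : Prog → Prog → Prog → Prog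
  /-- `loop c P`: as long as the test `c` on a copy of the register gives a result other than
  `nil`, run `P` -/
  | loop : Prog → Prog → Prog

/-- The program tosses no coin. -/
def Prog.CoinFree : Prog → Prop
  | .skip | .nil | .car | .cdr => True
  | .flip => False
  | .pair P Q | .seq P Q | .loop P Q => P.CoinFree ∧ Q.CoinFree
  | .ite c P Q => c.CoinFree ∧ P.CoinFree ∧ Q.CoinFree

open Val in
/-- `Exec ω P x i y j t`: with the outcomes of the coin tosses given by `ω`, of which the first `i`
are already used up, the program `P`, started with `x` in the register, halts after exactly `t`
steps with `y` in the register, and the first `j` coin tosses are then used up. -/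
inductive Exec (ω : ℕ → Bool) : Prog → Val → ℕ → Val → ℕ → ℕ → Prop
  | skip (x i) : Exec ω .skip x i x i 1
  | nil (x i) : Exec ω .nil x i nil i 1
  | car (x i) : Exec ω .car x i x.car i 1
  | cdr (x i) : Exec ω .cdr x i x.cdr i 1
  | flip (x i) : Exec ω .flip x i (ofBool (ω i)) (i + 1) 1
  | pair {P Q x i y j z k s t} : Exec ω P x i y j s → Exec ω Q x j z k t →
      Exec ω (.pair P Q) x i (cons y z) k (s + t + 1)
  | seq {P Q x i y j z k s t} : Exec ω P x i y j s → Exec ω Q y j z k t →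
      Exec ω (.seq P Q) x i z k (s + t + 1)
  | ite_true {c P Q x i b j y k s t} : Exec ω c x i b j s → b ≠ nil → Exec ω P x j y k t →
      Exec ω (.ite c P Q) x i y k (s + t + 1)
  | ite_false {c P Q x i j y k s t} : Exec ω c x i nil j s → Exec ω Q x j y k t →
      Exec ω (.ite c P Q) x i y k (s + t + 1)
  | loop_done {c P x i j s} : Exec ω c x i nil j s →
      Exec ω (.loop c P) x i x j (s + 1)
  | loop_step {c P x i b j y k z l s t u} : Exec ω c x i b j s → b ≠ nil →
      Exec ω P x j y k t → Exec ω (.loop c P) y k z l u →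
      Exec ω (.loop c P) x i z l (s + t + u + 1)

/-- On input `x` and coin tosses `ω`, the program `P` halts with output `y`. -/
def Outputs (P : Prog) (ω : ℕ → Bool) (x y : Val) : Prop :=
  ∃ j t, Exec ω P x 0 y j t

/-- On input `x` and coin tosses `ω`, the program `P` halts after at most `T` steps. -/
def HaltsWithin (P : Prog) (ω : ℕ → Bool) (x : Val) (T : ℕ) : Prop :=
  ∃ y j t, Exec ω P x 0 y j t ∧ t ≤ T

/-- The law of an infinite sequence of independent fair coin tosses. -/
def coinTosses : MeasureTheory.Measure (ℕ → Bool) :=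
  MeasureTheory.Measure.infinitePi fun _ => (PMF.uniformOfFintype Bool).toMeasure

/-! ### Parameterized promise problems and FPT algorithms -/

/-- A parameterized promise problem: instances (with their encoding as machine inputs), the
parameter of an instance, and disjoint sets of YES and NO instances. -/
structure PromiseProblem where
  Inst : Type
  encode : Inst → Val
  param : Inst → ℕ
  yes : Set Inst
  no : Set Inst
  disjoint : Disjoint yes no

/-- `P` runs in time `f(k) * |x| ^ c`, for a computable function `f` and a constant `c`, on every
instance and every outcome of the coin tosses. -/
def RunsInFPTTime (A : PromiseProblem) (P : Prog) : Prop :=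
  ∃ (f : ℕ → ℕ) (c : ℕ), Computable f ∧ ∀ (I : A.Inst) (ω : ℕ → Bool),
    HaltsWithin P ω (A.encode I) (f (A.param I) * (A.encode I).size ^ c)

/-- `P` is a (deterministic) FPT algorithm for `A`. -/
structure IsFPTAlgorithm (A : PromiseProblem) (P : Prog) : Prop where
  coinFree : P.CoinFree
  time : RunsInFPTTime A P
  yes : ∀ I ∈ A.yes, ∀ ω, Outputs P ω (A.encode I) (Val.ofBool true)
  no : ∀ I ∈ A.no, ∀ ω, Outputs P ω (A.encode I) (Val.ofBool false)

/-- `P` is a randomized FPT algorithm for `A` (Monte Carlo, with two-sided error). -/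
structure IsRandomizedFPTAlgorithm (A : PromiseProblem) (P : Prog) : Prop where
  time : RunsInFPTTime A P
  yes : ∀ I ∈ A.yes,
    (2 / 3 : ℝ) ≤ coinTosses.real {ω | Outputs P ω (A.encode I) (Val.ofBool true)}
  no : ∀ I ∈ A.no,
    (2 / 3 : ℝ) ≤ coinTosses.real {ω | Outputs P ω (A.encode I) (Val.ofBool false)}

/-! ### 2CSP and the Parameterized Inapproximability Hypothesis -/

/-- An edge of a constraint graph on the vertex set `Fin k` together with its constraint, a subset
of `Σ × Σ` for the alphabet `Σ = Fin s`. The endpoints of an undirected edge are listed in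
increasing order. -/
structure Constraint (k s : ℕ) where
  u : Fin k
  v : Fin k
  lt : u < v
  rel : Finset (Fin s × Fin s)

/-- A 2CSP instance. The constraint graph is a simple undirected graph on `Fin k`, given by the
list of its edges. The alphabet and the edge set are nonempty, so that the value is defined. -/
structure TwoCSP where
  k : ℕ
  s : ℕ
  edges : List (Constraint k s)
  nodup : (edges.map fun e => (e.u, e.v)).Nodup
  s_pos : 0 < s
  edges_ne : edges ≠ []

namespace TwoCSP

/-- The fraction of the edges that the assignment `ψ` satisfies. -/
def assignmentValue (Γ : TwoCSP) (ψ : Fin Γ.k → Fin Γ.s) : ℝ :=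
  (Γ.edges.countP fun e => decide ((ψ e.u, ψ e.v) ∈ e.rel) : ℝ) / (Γ.edges.length : ℝ)

/-- The value of the instance: the maximum over the (finitely many) assignments. -/
def value (Γ : TwoCSP) : ℝ := ⨆ ψ : Fin Γ.k → Fin Γ.s, Γ.assignmentValue ψ

/-- The truth table of a constraint. -/
def encodeRel {s : ℕ} (R : Finset (Fin s × Fin s)) : Val :=
  Val.ofList (List.ofFn fun a : Fin s => Val.ofList (List.ofFn fun b : Fin s =>
    Val.ofBool (decide ((a, b) ∈ R))))

def encodeEdge {k s : ℕ} (e : Constraint k s) : Val :=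
  .cons (Val.unary e.u) (.cons (Val.unary e.v) (encodeRel e.rel))

/-- The encoding lists the vertices and the alphabet symbols (in unary), and then the edges with
their constraints. -/
def encode (Γ : TwoCSP) : Val :=
  .cons (Val.unary Γ.k) (.cons (Val.unary Γ.s) (Val.ofList (Γ.edges.map encodeEdge)))

end TwoCSP

/-- The `ε`-gap 2CSP problem, parameterized by the number of vertices. -/
def gapTwoCSP (ε : ℝ) (hε : 0 ≤ ε) : PromiseProblem where
  Inst := TwoCSP
  encode := TwoCSP.encode
  param := TwoCSP.k
  yes := {Γ | Γ.value = 1}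
  no := {Γ | Γ.value < 1 - ε}
  disjoint := Set.disjoint_left.2 fun Γ h1 h2 => by
    simp only [Set.mem_ofPred_eq] at h1 h2
    linarith

/-- The Parameterized Inapproximability Hypothesis. -/
def PIH : Prop :=
  ∃ (ε : ℝ) (hε : 0 < ε), ¬ ∃ P : Prog, IsRandomizedFPTAlgorithm (gapTwoCSP ε hε.le) P

/-! ### The gap closest vector problem -/

/-- An instance `(B, y, t)`. -/
structure CVPInstance where
  n : ℕ
  q : ℕ
  n_pos : 0 < n
  q_pos : 0 < q
  B : Matrix (Fin n) (Fin q) ℤ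
  y : Fin n → ℤ
  t : ℕ
  t_pos : 0 < t

/-- The matrix row by row, the target vector and the threshold, all numbers in binary. -/
def CVPInstance.encode (I : CVPInstance) : Val :=
  .cons (Val.ofList (List.ofFn fun i => Val.ofList (List.ofFn fun j => Val.ofInt (I.B i j))))
    (.cons (Val.ofList (List.ofFn fun i => Val.ofInt (I.y i))) (Val.binary I.t))

/-- The `ℓ_p` norm of an integer vector. -/
def lpNorm {n : ℕ} (p : ℝ) (v : Fin n → ℤ) : ℝ :=
  ‖WithLp.toLp (ENNReal.ofReal p) (fun i => (v i : ℝ))‖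

open Matrix in
/-- The gap version of the closest vector problem with a `{0,1}`-valued error vector in the YES
case and with all nonzero integer multiples of the target in the NO case; the parameter is `t`. -/
def gapCVP (γ p : ℝ) (hγ : 1 ≤ γ) : PromiseProblem where
  Inst := CVPInstance
  encode := CVPInstance.encode
  param := CVPInstance.t
  yes := {I | ∃ x : Fin I.q → ℤ, (∀ i, (I.B *ᵥ x - I.y) i ∈ ({0, 1} : Set ℤ)) ∧
    lpNorm p (I.B *ᵥ x - I.y) ^ p ≤ (I.t : ℝ)}
  no := {I | ∀ (x : Fin I.q → ℤ) (w : ℤ), w ≠ 0 →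
    γ * (I.t : ℝ) < lpNorm p (I.B *ᵥ x - w • I.y) ^ p}
  disjoint := Set.disjoint_left.2 fun I h1 h2 => by
    obtain ⟨x, -, hx⟩ := h1
    have h := h2 x 1 one_ne_zero
    rw [one_smul] at h
    have ht : (0 : ℝ) ≤ I.t := Nat.cast_nonneg _
    nlinarith

end ParamComplexity

end

/-!
The proof is a reduction that turns a 2CSP instance with `m` edges into a lattice problem with
threshold `m ^ r`, for a constant `r`.

*The base system.* Take a variable for every choice, that is, every edge together with a pair of
symbols that satisfies its constraint, and a variable for every vertex and symbol. Require that the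
choices of each edge sum up to `w`, and that the choices of an edge that use the symbol `a` at an
endpoint `v` sum up to the variable of `(v, a)`. A satisfying assignment gives a solution with
entries in `{0, 1}` and `w = 1` in which `m` choices are nonzero. Conversely, let `w ≠ 0`. Then
each edge has a nonzero choice, and an edge with exactly one nonzero choice determines the symbols
at both of its endpoints. So all edges violated by an assignment read off from the vertex variables
have two nonzero choices, and if the value is less than `1 - ε`, then at least `(1 + ε) * m`
choices are nonzero (`le_countP_choices`).

*Amplification.* Put a copy of the base system below every choice, with the variable of that choice
as its `w`, and repeat this to depth `r`. The numbers of nonzero leaves become `m ^ r` and at least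
`((1 + ε) * m) ^ r` (`countP_agrees_tuples`, `pow_le_countP_tuples`), a gap larger than `γ` if `r`
is large. In the lattice problem the root weight `w` is the multiplier of the target vector, the
leaves are coordinates of their own, and the equations are scaled by a number larger than
`γ * m ^ r`. Since all coordinates are integers, the `p`-th power of the norm is at least the number
of nonzero coordinates, for every `p ≥ 1` (`latticeInstance_yes`, `latticeInstance_no`).

*Running time.* The reduction is written as a composition of functions on typed data, and a small
calculus of functions that are computable in polynomial time in the machine model (`PolyTime`) is
closed under the operations used, the basic one being the bounded loop (`PolyTime.loop`). As
`m ≤ k ^ 2` for `k` vertices, the new parameter is at most `k ^ (2 * r)`, so a randomized FPT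
algorithm for the lattice problem would refute PIH (`exists_isRandomizedFPTAlgorithm_of_reduction`).
A deterministic algorithm is a randomized one that errs with probability `0`.
-/

namespace ParamComplexity

/-! ### Typed data and polynomial bounds -/

theorem Val.one_le_size : ∀ v : Val, 1 ≤ v.size
  | .nil => le_rfl
  | .cons _ _ => Nat.le_add_left _ _

/-- A type whose elements are represented by machine values. -/
class Enc (α : Type) where
  /-- The encoding. -/
  enc : α → Val

open Enc (enc)

/-- The length of the encoding. -/
def sz {α : Type} [Enc α] (a : α) : ℕ := (enc a).size

section Encodings

variable {α β : Type} [Enc α] [Enc β]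

instance : Enc Val := ⟨id⟩

instance : Enc Unit := ⟨fun _ => .nil⟩

instance : Enc Bool := ⟨Val.ofBool⟩

/-- Natural numbers are encoded in unary. Binary numbers are handled as their lists of bits. -/
instance : Enc ℕ := ⟨Val.unary⟩

instance : Enc ℤ := ⟨Val.ofInt⟩

instance : Enc (α × β) := ⟨fun p => .cons (enc p.1) (enc p.2)⟩

instance : Enc (List α) := ⟨fun l => Val.ofList (l.map enc)⟩

theorem enc_pair (a : α) (b : β) : enc (a, b) = .cons (enc a) (enc b) := rfl

theorem enc_cons (a : α) (l : List α) : enc (a :: l) = .cons (enc a) (enc l) := rfl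

theorem enc_replicate_unit (n : ℕ) : enc (List.replicate n ()) = enc n := by
  change Val.ofList _ = Val.ofList _
  rw [List.map_replicate]
  rfl

theorem enc_nat_succ (n : ℕ) : enc (n + 1) = .cons .nil (enc n) := by
  change Val.ofList _ = Val.cons _ (Val.ofList _)
  rw [List.replicate_succ]
  rfl

theorem one_le_sz (a : α) : 1 ≤ sz a := Val.one_le_size _

theorem sz_pair (a : α) (b : β) : sz (a, b) = sz a + sz b + 1 := rfl

theorem sz_nil : sz ([] : List α) = 1 := rfl

theorem sz_cons (a : α) (l : List α) : sz (a :: l) = sz a + sz l + 1 := rfl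

theorem length_le_sz (l : List α) : l.length ≤ sz l := by
  induction l with
  | nil => simp
  | cons a l ih => rw [sz_cons, List.length_cons]; omega

theorem sz_le_of_mem {a : α} {l : List α} (h : a ∈ l) : sz a ≤ sz l := by
  induction l with
  | nil => simp at h
  | cons b l ih =>
    rw [sz_cons]
    rcases List.mem_cons.1 h with rfl | h
    · omega
    · have := ih h; omega

theorem sz_le_of_forall {l : List α} {K : ℕ} (h : ∀ a ∈ l, sz a ≤ K) :
    sz l ≤ l.length * (K + 1) + 1 := by
  induction l with
  | nil => simp [sz_nil]
  | cons b l ih =>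
    rw [sz_cons, List.length_cons, add_mul]
    have h1 := ih fun a ha => h a (List.mem_cons_of_mem _ ha)
    have h2 := h b List.mem_cons_self
    omega

theorem sz_append (l m : List α) : sz (l ++ m) + 1 = sz l + sz m := by
  induction l with
  | nil => simp [sz_nil, add_comm]
  | cons b l ih => rw [List.cons_append, sz_cons, sz_cons]; omega

theorem sz_reverse (l : List α) : sz l.reverse = sz l := by
  induction l with
  | nil => rfl
  | cons b l ih =>
    have := sz_append l.reverse [b]
    rw [List.reverse_cons, sz_cons]
    rw [sz_cons, sz_nil] at this
    omega

theorem sz_nat (n : ℕ) : sz n = 2 * n + 1 := by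
  induction n with
  | zero => rfl
  | succ n ih =>
    change (enc (n + 1)).size = _
    rw [enc_nat_succ]
    change 1 + sz n + 1 = _
    omega

theorem sz_bool_le (b : Bool) : sz b ≤ 3 := by
  cases b
  · exact (by decide : 1 ≤ 3)
  · exact le_refl 3

end Encodings

/-- `g` is bounded by a polynomial in the length of its argument. The base `sz a + 2` is at
least `3`, so that powers of it absorb sums and constants. -/
def PolyBound {α : Type} [Enc α] (g : α → ℕ) : Prop := ∃ c : ℕ, ∀ a, g a ≤ (sz a + 2) ^ c

namespace PolyBound

variable {α β : Type} [Enc α] [Enc β] {f g : α → ℕ}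

theorem mono (hg : PolyBound g) (h : ∀ a, f a ≤ g a) : PolyBound f :=
  let ⟨c, hc⟩ := hg
  ⟨c, fun a => (h a).trans (hc a)⟩

theorem const (n : ℕ) : PolyBound fun _ : α => n :=
  ⟨n, fun _ => Nat.lt_two_pow_self.le.trans (Nat.pow_le_pow_left (by omega) n)⟩

theorem size : PolyBound fun a : α => sz a := ⟨1, fun a => by simp⟩

theorem add (hf : PolyBound f) (hg : PolyBound g) : PolyBound fun a => f a + g a := by
  obtain ⟨c, hc⟩ := hf
  obtain ⟨d, hd⟩ := hg
  refine ⟨c + d + 1, fun a => ?_⟩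
  have h1 : (sz a + 2) ^ c ≤ (sz a + 2) ^ (c + d) := Nat.pow_le_pow_right (by omega) (by omega)
  have h2 : (sz a + 2) ^ d ≤ (sz a + 2) ^ (c + d) := Nat.pow_le_pow_right (by omega) (by omega)
  have h3 := hc a
  have h4 := hd a
  rw [pow_succ]
  nlinarith [Nat.zero_le (sz a * (sz a + 2) ^ (c + d))]

theorem mul (hf : PolyBound f) (hg : PolyBound g) : PolyBound fun a => f a * g a := by
  obtain ⟨c, hc⟩ := hf
  obtain ⟨d, hd⟩ := hg
  exact ⟨c + d, fun a => by rw [pow_add]; exact Nat.mul_le_mul (hc a) (hd a)⟩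

theorem pow (hf : PolyBound f) (n : ℕ) : PolyBound fun a => f a ^ n := by
  obtain ⟨c, hc⟩ := hf
  exact ⟨c * n, fun a => by rw [pow_mul]; exact Nat.pow_le_pow_left (hc a) n⟩

theorem comp {h : β → ℕ} {k : α → β} (hh : PolyBound h) (hk : PolyBound fun a => sz (k a)) :
    PolyBound fun a => h (k a) := by
  obtain ⟨c, hc⟩ := hh
  exact ((hk.add (const 2)).pow c).mono fun a => hc (k a)

end PolyBound

/-! ### Functions computable in polynomial time -/

/-- Without tossing coins, `P` takes `x` to `y` in exactly `t` steps. -/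
def Runs (P : Prog) (x y : Val) (t : ℕ) : Prop := ∀ ω i, Exec ω P x i y i t

/-- `f` is computed on the encodings by a program that tosses no coins and takes polynomial time.
The bound on the length of the output does not follow from the one on the time, since values share
subtrees in the machine model. -/
def PolyTime {α β : Type} [Enc α] [Enc β] (f : α → β) : Prop :=
  ∃ (P : Prog) (T : α → ℕ), PolyBound T ∧ PolyBound (fun a => sz (f a)) ∧
    ∀ a, Runs P (enc a) (enc (f a)) (T a)

namespace PolyTime

variable {α β γ δ : Type} [Enc α] [Enc β] [Enc γ] [Enc δ]

theorem intro_le {f : α → β} (P : Prog) {T : α → ℕ} (hT : PolyBound T)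
    (hf : PolyBound fun a => sz (f a)) (h : ∀ a, ∃ t ≤ T a, Runs P (enc a) (enc (f a)) t) :
    PolyTime f := by
  choose t ht hr using h
  exact ⟨P, t, hT.mono ht, hf, hr⟩

theorem size_bound {f : α → β} (hf : PolyTime f) : PolyBound fun a => sz (f a) := by
  obtain ⟨P, T, hT, hs, h⟩ := hf
  exact hs

/-- A function may be replaced by one with the same outputs up to encoding. -/
theorem of_enc_eq {f : α → β} {g : α → γ} (hf : PolyTime f) (h : ∀ a, enc (g a) = enc (f a)) :
    PolyTime g := by
  obtain ⟨P, T, hT, hs, hr⟩ := hf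
  refine ⟨P, T, hT, hs.mono fun a => ?_, fun a => ?_⟩
  · rw [sz, sz, h]
  · rw [h]; exact hr a

theorem of_eq {f g : α → β} (hf : PolyTime f) (h : ∀ a, g a = f a) : PolyTime g :=
  hf.of_enc_eq fun a => by rw [h]

protected theorem id : PolyTime fun a : α => a :=
  ⟨.skip, fun _ => 1, .const 1, .size, fun _ _ i => Exec.skip _ i⟩

theorem comp {f : β → γ} {g : α → β} (hf : PolyTime f) (hg : PolyTime g) :
    PolyTime fun a => f (g a) := by
  obtain ⟨P, T, hT, hs, hr⟩ := hf
  obtain ⟨Q, U, hU, hs', hr'⟩ := hg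
  exact ⟨.seq Q P, fun a => U a + T (g a) + 1, (hU.add (hT.comp hs')).add (.const 1), hs.comp hs',
    fun a ω i => (hr' a ω i).seq (hr (g a) ω i)⟩

theorem pair {f : α → β} {g : α → γ} (hf : PolyTime f) (hg : PolyTime g) :
    PolyTime fun a => (f a, g a) := by
  obtain ⟨P, T, hT, hs, hr⟩ := hf
  obtain ⟨Q, U, hU, hs', hr'⟩ := hg
  exact ⟨.pair P Q, fun a => T a + U a + 1, (hT.add hU).add (.const 1), (hs.add hs').add (.const 1),
    fun a ω i => (hr a ω i).pair (hr' a ω i)⟩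

protected theorem fst : PolyTime fun p : α × β => p.1 :=
  ⟨.car, fun _ => 1, .const 1, PolyBound.size.mono fun p => by
    rcases p with ⟨a, b⟩; rw [sz_pair]; dsimp only; omega, fun p ω i => Exec.car (enc p) i⟩

protected theorem snd : PolyTime fun p : α × β => p.2 :=
  ⟨.cdr, fun _ => 1, .const 1, PolyBound.size.mono fun p => by
    rcases p with ⟨a, b⟩; rw [sz_pair]; dsimp only; omega, fun p ω i => Exec.cdr (enc p) i⟩

theorem fst' {f : α → β × γ} (hf : PolyTime f) : PolyTime fun a => (f a).1 := PolyTime.fst.comp hf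

theorem snd' {f : α → β × γ} (hf : PolyTime f) : PolyTime fun a => (f a).2 := PolyTime.snd.comp hf

theorem const (b : β) : PolyTime fun _ : α => b := by
  have key : ∀ v : Val, ∃ P t, ∀ x, Runs P x v t := by
    intro v
    induction v with
    | nil => exact ⟨.nil, 1, fun x ω i => Exec.nil x i⟩
    | cons a b iha ihb =>
      obtain ⟨P, s, hP⟩ := iha
      obtain ⟨Q, t, hQ⟩ := ihb
      exact ⟨.pair P Q, _, fun x ω i => (hP x ω i).pair (hQ x ω i)⟩
  obtain ⟨P, t, h⟩ := key (enc b)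
  exact ⟨P, fun _ => t, .const t, .const _, fun a => h _⟩

theorem cons {f : α → β} {g : α → List β} (hf : PolyTime f) (hg : PolyTime g) :
    PolyTime fun a => f a :: g a :=
  (hf.pair hg).of_enc_eq fun _ => rfl

theorem ite {p : α → Bool} {f g : α → β} (hp : PolyTime p) (hf : PolyTime f) (hg : PolyTime g) :
    PolyTime fun a => if p a then f a else g a := by
  obtain ⟨R, V, hV, -, hr⟩ := hp
  obtain ⟨P, T, hT, hs, hr₁⟩ := hf
  obtain ⟨Q, U, hU, hs', hr₂⟩ := hg
  refine intro_le (.ite R P Q) ((hV.add (hT.add hU)).add (.const 1))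
    ((hs.add hs').mono fun a => ?_) fun a => ?_
  · split_ifs <;> omega
  · cases h : p a with
    | true =>
      refine ⟨V a + T a + 1, by omega, fun ω i => ?_⟩
      have := hr a ω i
      rw [h] at this
      simpa using Exec.ite_true this (fun hh => Val.noConfusion hh) (hr₁ a ω i)
    | false =>
      refine ⟨V a + U a + 1, by omega, fun ω i => ?_⟩
      have := hr a ω i
      rw [h] at this
      simpa using Exec.ite_false this (hr₂ a ω i)

theorem list_cases {l : α → List β} {f : α → γ} {g : α → β → List β → γ} (hl : PolyTime l)
    (hf : PolyTime f) (hg : PolyTime fun p : α × β × List β => g p.1 p.2.1 p.2.2) :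
    PolyTime fun a => match l a with
      | [] => f a
      | b :: m => g a b m := by
  obtain ⟨R, V, hV, hs, hr⟩ := hl
  obtain ⟨P, T, hT, hs₁, hr₁⟩ := hf
  obtain ⟨Q, U, ⟨c, hU⟩, ⟨d, hs₂⟩, hr₂⟩ := hg
  have hB : ∀ a b m, l a = b :: m → sz (a, b, m) + 2 ≤ sz a + sz (l a) + 3 := by
    intro a b m h
    rw [h, sz_pair, sz_pair, sz_cons]
  have hB' : PolyBound fun a => sz a + sz (l a) + 3 := (PolyBound.size.add hs).add (.const 3)
  refine intro_le (.ite R (.seq (.pair .skip R) Q) P)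
    (T := fun a => V a + (T a + (V a + (sz a + sz (l a) + 3) ^ c)) + 4)
    ((hV.add (hT.add (hV.add (hB'.pow c)))).add (.const 4))
    ((hs₁.add (hB'.pow d)).mono fun a => ?_) fun a => ?_
  · split
    · omega
    · rename_i b m h
      have := (hs₂ (a, b, m)).trans
        (Nat.pow_le_pow_left (hB a b m h) d)
      dsimp only at this
      omega
  · have h0 := hr a
    split
    · rename_i h
      rw [h] at h0
      exact ⟨V a + T a + 1, by omega, fun ω i => Exec.ite_false (h0 ω i) (hr₁ a ω i)⟩
    · rename_i b m h
      have := (hU (a, b, m)).trans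
        (Nat.pow_le_pow_left (hB a b m h) c)
      rw [h] at h0
      refine ⟨V a + ((1 + V a + 1) + U (a, b, m) + 1) + 1, by omega, fun ω i => ?_⟩
      exact Exec.ite_true (h0 ω i) (fun hh => Val.noConfusion hh)
        (((Exec.skip _ i).pair (h0 ω i)).seq (hr₂ (a, b, m) ω i))

/-- A loop whose number of rounds and whose intermediate states are polynomially bounded. -/
theorem loop {init : α → β} {cont : β → Bool} {step : β → β} {n b : α → ℕ} (hinit : PolyTime init)
    (hcont : PolyTime cont) (hstep : PolyTime step) (hn : PolyBound n) (hb : PolyBound b)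
    (hc : ∀ a m, m < n a → cont (step^[m] (init a)) = true)
    (hd : ∀ a, cont (step^[n a] (init a)) = false)
    (hs : ∀ a m, m ≤ n a → sz (step^[m] (init a)) ≤ b a) :
    PolyTime fun a => step^[n a] (init a) := by
  obtain ⟨I, S, hS, -, hI⟩ := hinit
  obtain ⟨C, T, ⟨c, hT⟩, -, hC⟩ := hcont
  obtain ⟨Q, U, ⟨d, hU⟩, -, hQ⟩ := hstep
  have hb' : PolyBound fun a => b a + 2 := hb.add (.const 2)
  refine intro_le (.seq I (.loop C Q))
    (T := fun a => S a + (n a + 1) * ((b a + 2) ^ c + (b a + 2) ^ d + 1) + 1)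
    ((hS.add ((hn.add (.const 1)).mul (((hb'.pow c).add (hb'.pow d)).add (.const 1)))).add
      (.const 1))
    (hb.mono fun a => hs a _ le_rfl) fun a => ?_
  have hT' : ∀ m ≤ n a, T (step^[m] (init a)) ≤ (b a + 2) ^ c := fun m hm =>
    (hT _).trans (Nat.pow_le_pow_left (Nat.add_le_add_right (hs a m hm) 2) c)
  have hU' : ∀ m ≤ n a, U (step^[m] (init a)) ≤ (b a + 2) ^ d := fun m hm =>
    (hU _).trans (Nat.pow_le_pow_left (Nat.add_le_add_right (hs a m hm) 2) d)
  set K := (b a + 2) ^ c + (b a + 2) ^ d + 1 with hK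
  -- the rounds that remain when `k` of them are left to do
  have key : ∀ k ≤ n a, ∃ t ≤ (k + 1) * K,
      Runs (.loop C Q) (enc (step^[n a - k] (init a))) (enc (step^[n a] (init a))) t := by
    intro k
    induction k with
    | zero =>
      intro _
      refine ⟨T (step^[n a] (init a)) + 1, ?_, fun ω i => ?_⟩
      · have := hT' _ le_rfl
        omega
      · have := hC (step^[n a] (init a)) ω i
        rw [hd a] at this
        exact Exec.loop_done this
    | succ k ih =>
      intro hk
      obtain ⟨t, ht, hrun⟩ := ih (by omega)
      have h1 := hT' (n a - (k + 1)) (by omega)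
      have h2 := hU' (n a - (k + 1)) (by omega)
      refine ⟨T (step^[n a - (k + 1)] (init a)) + U (step^[n a - (k + 1)] (init a)) + t + 1,
        ?_, fun ω i => ?_⟩
      · rw [add_mul (k + 1) 1 K, one_mul]
        omega
      · have h3 := hC (step^[n a - (k + 1)] (init a)) ω i
        rw [hc a _ (by omega)] at h3
        refine Exec.loop_step h3 (fun hh => Val.noConfusion hh) (hQ _ ω i) ?_
        rw [← Function.iterate_succ_apply' step, show (n a - (k + 1)).succ = n a - k by omega]
        exact hrun ω i
  obtain ⟨t, ht, hrun⟩ := key (n a) le_rfl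
  rw [Nat.sub_self] at hrun
  exact ⟨S a + t + 1, by omega, fun ω i => (hI a ω i).seq (hrun ω i)⟩

/-! ### Lists -/

theorem isEmpty_not {l : α → List β} (hl : PolyTime l) : PolyTime fun a => !(l a).isEmpty :=
  (list_cases hl (f := fun _ => false) (g := fun _ _ _ => true) (const _) (const _)).of_eq
    fun a => by cases h : l a <;> rfl

theorem foldl {l : α → List β} {s₀ : α → γ} {g : α → γ → β → γ} {b : α → ℕ} (hl : PolyTime l)
    (hs₀ : PolyTime s₀) (hg : PolyTime fun p : α × γ × β => g p.1 p.2.1 p.2.2) (hb : PolyBound b)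
    (h : ∀ a m, m <+: l a → sz (m.foldl (g a) (s₀ a)) ≤ b a) :
    PolyTime fun a => (l a).foldl (g a) (s₀ a) := by
  -- the state of the loop: the environment, the accumulator and the rest of the list
  let step : α × γ × List β → α × γ × List β := fun s =>
    match s.2.2 with
    | [] => s
    | x :: m => (s.1, g s.1 s.2.1 x, m)
  have hstep : PolyTime step :=
    list_cases (PolyTime.snd.comp PolyTime.snd) PolyTime.id
      (g := fun s x m => (s.1, g s.1 s.2.1 x, m))
      (pair PolyTime.fst.fst' (pair (hg.comp
        (pair PolyTime.fst.fst' (pair PolyTime.fst.snd'.fst' PolyTime.snd.fst')))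
          PolyTime.snd.snd'))
  have hiter : ∀ a m, m ≤ (l a).length → step^[m] (a, s₀ a, l a) =
      (a, ((l a).take m).foldl (g a) (s₀ a), (l a).drop m) := by
    intro a m
    induction m with
    | zero => intro _; simp
    | succ m ih =>
      intro hm
      have hm' : m < (l a).length := hm
      rw [Function.iterate_succ_apply', ih hm'.le, List.take_add_one, List.getElem?_eq_getElem hm',
        List.foldl_append]
      simp only [step, List.drop_eq_getElem_cons hm', Option.toList, List.foldl_cons,
        List.foldl_nil]
  have hloop := loop (init := fun a => (a, s₀ a, l a)) (cont := fun s => !s.2.2.isEmpty)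
    (step := step) (n := fun a => (l a).length) (b := fun a => sz a + (b a + sz (l a) + 1) + 1)
    (PolyTime.id.pair (hs₀.pair hl)) (isEmpty_not PolyTime.snd.snd') hstep
    (hl.size_bound.mono fun a => length_le_sz _)
    ((PolyBound.size.add ((hb.add hl.size_bound).add (.const 1))).add (.const 1)) ?_ ?_ ?_
  · refine hloop.snd'.fst'.of_eq fun a => ?_
    rw [hiter a _ le_rfl, List.take_length]
  · intro a m hm
    rw [hiter a m hm.le]
    simp [hm]
  · intro a
    simp [hiter a _ le_rfl]
  · intro a m hm
    rw [hiter a m hm, sz_pair, sz_pair]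
    have h1 := h a _ (List.take_prefix m (l a))
    have h2 := sz_append ((l a).take m) ((l a).drop m)
    rw [List.take_append_drop] at h2
    have h3 := one_le_sz ((l a).take m)
    omega

theorem reverse {l : α → List β} (hl : PolyTime l) : PolyTime fun a => (l a).reverse := by
  have hf : ∀ m : List β, m.foldl (fun acc x => x :: acc) [] = m.reverse := fun m => by
    simp
  refine (foldl (s₀ := fun _ => []) (g := fun _ acc x => x :: acc) hl (const [])
    (cons PolyTime.snd.snd' PolyTime.snd.fst') hl.size_bound fun a m hm => ?_).of_eq
      fun a => (hf _).symm
  obtain ⟨m', hm'⟩ := hm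
  have := sz_append m m'
  have := one_le_sz m'
  rw [hf, sz_reverse, ← hm']
  omega

theorem append {l m : α → List β} (hl : PolyTime l) (hm : PolyTime m) :
    PolyTime fun a => l a ++ m a := by
  have hf : ∀ l m : List β, l.foldl (fun acc x => x :: acc) m = l.reverse ++ m := fun l m => by
    simp
  refine (foldl (g := fun _ acc x => x :: acc) hl.reverse hm
    (cons PolyTime.snd.snd' PolyTime.snd.fst') (hl.size_bound.add hm.size_bound)
    fun a m' hm' => ?_).of_eq fun a => by rw [hf, List.reverse_reverse]
  obtain ⟨m'', h⟩ := hm'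
  have h1 := sz_append m' m''
  have h2 := one_le_sz m''
  have h3 := sz_append m'.reverse (m a)
  rw [h, sz_reverse] at h1
  rw [sz_reverse] at h3
  rw [hf]
  omega

theorem flatMap {l : α → List β} {f : α → β → List γ} (hl : PolyTime l)
    (hf : PolyTime fun p : α × β => f p.1 p.2) : PolyTime fun a => (l a).flatMap (f a) := by
  have hfold : ∀ (a : α) (m : List β) (acc : List γ),
      m.foldl (fun acc x => acc ++ f a x) acc = acc ++ m.flatMap (f a) := by
    intro a m
    induction m with
    | nil => simp
    | cons x m ih => intro acc; simp [ih]
  obtain ⟨c, hc⟩ := hf.size_bound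
  refine (foldl (s₀ := fun _ => []) (g := fun a acc x => acc ++ f a x)
    (b := fun a => sz (l a) * (sz a + sz (l a) + 3) ^ c + 1) hl (const [])
    (append PolyTime.snd.fst' (hf.comp (pair PolyTime.fst PolyTime.snd.snd')))
    ((hl.size_bound.mul (((PolyBound.size.add hl.size_bound).add (.const 3)).pow c)).add
      (.const 1)) fun a m hm => ?_).of_eq fun a => by rw [hfold]; simp
  rw [hfold, List.nil_append]
  have hlen : m.length ≤ sz (l a) := hm.length_le.trans (length_le_sz _)
  have hm' : ∀ x ∈ m, sz (f a x) ≤ (sz a + sz (l a) + 3) ^ c := fun x hx => by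
    refine (hc (a, x)).trans (Nat.pow_le_pow_left ?_ c)
    have := sz_le_of_mem (hm.subset hx)
    rw [sz_pair]
    omega
  have key : sz (m.flatMap (f a)) ≤ m.length * (sz a + sz (l a) + 3) ^ c + 1 := by
    clear hm hlen
    induction m with
    | nil => simp [sz_nil]
    | cons x m ih =>
      have h1 := ih fun y hy => hm' y (List.mem_cons_of_mem _ hy)
      have h2 := hm' x List.mem_cons_self
      have h3 := sz_append (f a x) (m.flatMap (f a))
      rw [List.flatMap_cons, List.length_cons, add_mul, one_mul]
      omega
  exact key.trans (Nat.add_le_add_right (Nat.mul_le_mul_right _ hlen) 1)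

theorem map {l : α → List β} {f : α → β → γ} (hl : PolyTime l)
    (hf : PolyTime fun p : α × β => f p.1 p.2) : PolyTime fun a => (l a).map (f a) :=
  (flatMap (f := fun a x => [f a x]) hl (cons hf (const []))).of_eq
    fun a => by rw [List.map_eq_flatMap]

theorem filter {l : α → List β} {p : α → β → Bool} (hl : PolyTime l)
    (hp : PolyTime fun q : α × β => p q.1 q.2) : PolyTime fun a => (l a).filter (p a) :=
  (flatMap (f := fun a x => if p a x then [x] else []) hl
    (ite hp (cons PolyTime.snd (const [])) (const []))).of_eq fun a => by
      induction l a with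
      | nil => rfl
      | cons x m ih => rw [List.flatMap_cons, ← ih, List.filter_cons]; split_ifs <;> rfl

theorem any {l : α → List β} {p : α → β → Bool} (hl : PolyTime l)
    (hp : PolyTime fun q : α × β => p q.1 q.2) : PolyTime fun a => (l a).any (p a) :=
  (isEmpty_not (hl.filter hp)).of_eq fun a => by
    rw [Bool.eq_iff_iff]
    simp

/-! ### Numbers -/

theorem succ {f : α → ℕ} (hf : PolyTime f) : PolyTime fun a => f a + 1 :=
  (pair (const ()) hf).of_enc_eq fun a => enc_nat_succ (f a)

theorem replicate_unit {f : α → ℕ} (hf : PolyTime f) : PolyTime fun a => List.replicate (f a) () :=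
  hf.of_enc_eq fun a => enc_replicate_unit (f a)

theorem length {l : α → List β} (hl : PolyTime l) : PolyTime fun a => (l a).length :=
  (map (f := fun _ _ => ()) hl (const ())).of_enc_eq fun a => by
    rw [← enc_replicate_unit, List.map_const']

theorem range {f : α → ℕ} (hf : PolyTime f) : PolyTime fun a => List.range (f a) := by
  have key : ∀ n, (List.replicate n ()).foldl (fun acc _ => acc.length :: acc) [] =
      (List.range n).reverse := by
    intro n
    induction n with
    | zero => rfl
    | succ n ih => rw [List.replicate_succ', List.foldl_append, ih, List.range_succ]; simp
  refine (foldl (s₀ := fun _ => ([] : List ℕ)) (g := fun _ acc _ => acc.length :: acc)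
    (b := fun a => sz (f a) * (sz (f a) + 1) + 1)
    hf.replicate_unit (const []) (cons PolyTime.snd.fst'.length PolyTime.snd.fst')
    ((hf.size_bound.mul (hf.size_bound.add (.const 1))).add (.const 1))
    fun a m hm => ?_).reverse.of_eq fun a => by rw [key, List.reverse_reverse]
  have hm' : m = List.replicate m.length () := List.eq_replicate_of_mem fun _ _ => rfl
  have hlen : m.length ≤ f a := by simpa using hm.length_le
  rw [hm', key, sz_reverse]
  refine (sz_le_of_forall (K := sz (f a)) fun x hx => ?_).trans ?_
  · rw [List.mem_range] at hx
    rw [sz_nat, sz_nat]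
    omega
  · rw [List.length_range]
    refine Nat.add_le_add_right (Nat.mul_le_mul_right _ ?_) 1
    rw [sz_nat]
    omega

theorem getD {l : α → List β} {f : α → ℕ} (d : β) (hl : PolyTime l) (hf : PolyTime f) :
    PolyTime fun a => (l a).getD (f a) d := by
  have key : ∀ (n : ℕ) (l : List β),
      (List.replicate n ()).foldl (fun m _ => m.tail) l = l.drop n := by
    intro n
    induction n with
    | zero => simp
    | succ n ih => intro l; rw [List.replicate_succ, List.foldl_cons, ih, List.drop_tail]
  have htail : PolyTime fun m : List β => m.tail :=
    (list_cases PolyTime.id (f := fun _ => []) (g := fun _ _ m => m) (const [])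
      PolyTime.snd.snd').of_eq fun m => by cases m <;> rfl
  have hdrop : PolyTime fun a => (l a).drop (f a) := by
    refine (foldl (g := fun _ m _ => m.tail) hf.replicate_unit hl (htail.comp PolyTime.snd.fst')
      hl.size_bound fun a m _ => ?_).of_eq fun a => (key _ _).symm
    have hm' : m = List.replicate m.length () := List.eq_replicate_of_mem fun _ _ => rfl
    have h1 := sz_append ((l a).take m.length) ((l a).drop m.length)
    have h2 := one_le_sz ((l a).take m.length)
    rw [List.take_append_drop] at h1
    rw [hm', key]
    omega
  exact (list_cases hdrop (f := fun _ => d) (g := fun _ x _ => x) (const d)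
    PolyTime.snd.fst').of_eq fun a => by
      rw [List.getD_eq_getElem?_getD, ← List.head?_drop]
      cases (l a).drop (f a) <;> rfl

theorem band {p q : α → Bool} (hp : PolyTime p) (hq : PolyTime q) :
    PolyTime fun a => p a && q a :=
  (ite hp hq (const false)).of_eq fun a => by cases p a <;> rfl

theorem bnot {p : α → Bool} (hp : PolyTime p) : PolyTime fun a => !p a :=
  (ite hp (const false) (const true)).of_eq fun a => by cases p a <;> rfl

theorem bxor {p q : α → Bool} (hp : PolyTime p) (hq : PolyTime q) :
    PolyTime fun a => p a ^^ q a :=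
  (ite hp hq.bnot hq).of_eq fun a => by cases p a <;> simp

end PolyTime

/-- A step of the ripple-carry increment of a list of bits, least significant bit first: the state
is the carry and the output in reverse. -/
def incrementStep (s : Bool × List Bool) (b : Bool) : Bool × List Bool :=
  (s.1 && b, (s.1 ^^ b) :: s.2)

theorem foldl_incrementStep_false (l acc : List Bool) :
    l.foldl incrementStep (false, acc) = (false, l.reverse ++ acc) := by
  induction l generalizing acc with
  | nil => rfl
  | cons b l ih => simp [incrementStep, ih]

theorem increment_bits (n : ℕ) (acc : List Bool) :
    (if (n.bits.foldl incrementStep (true, acc)).1 then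
        true :: (n.bits.foldl incrementStep (true, acc)).2
      else (n.bits.foldl incrementStep (true, acc)).2).reverse = acc.reverse ++ (n + 1).bits := by
  induction n using Nat.binaryRec' generalizing acc with
  | zero => simp
  | bit b m h ih =>
    rw [Nat.bits_append_bit m b h, List.foldl_cons]
    cases b with
    | false =>
      have : Nat.bit false m + 1 = Nat.bit true m := by simp [Nat.bit_val]
      rw [this, Nat.bits_append_bit m true (by simp)]
      simp [incrementStep, foldl_incrementStep_false]
    | true =>
      have : Nat.bit true m + 1 = Nat.bit false (m + 1) := by simp [Nat.bit_val]; ring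
      rw [this, Nat.bits_append_bit (m + 1) false (by simp)]
      have := ih (false :: acc)
      simpa [incrementStep] using this

namespace PolyTime

variable {α β γ δ : Type} [Enc α] [Enc β] [Enc γ] [Enc δ]

/-- The length of a list in binary, by counting. -/
theorem length_bits {l : α → List β} (hl : PolyTime l) : PolyTime fun a => (l a).length.bits := by
  let inc : List Bool → List Bool := fun m =>
    (if (m.foldl incrementStep (true, [])).1 then
      true :: (m.foldl incrementStep (true, [])).2
    else (m.foldl incrementStep (true, [])).2).reverse
  have hlen : ∀ (m : List Bool) (s : Bool × List Bool),
      (m.foldl incrementStep s).2.length = s.2.length + m.length := by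
    intro m
    induction m with
    | nil => simp
    | cons b m ih => intro s; rw [List.foldl_cons, ih]; simp [incrementStep]; ring
  have hbits : ∀ m : List Bool, sz m ≤ 4 * m.length + 1 := fun m => by
    have := sz_le_of_forall (l := m) (K := 3) fun b _ => sz_bool_le b
    omega
  have hfold : PolyTime fun m : List Bool => m.foldl incrementStep (true, []) := by
    refine foldl (s₀ := fun _ => (true, [])) (g := fun _ => incrementStep)
      (b := fun m => 4 * sz m + 5) PolyTime.id (const _) ?_
      (((PolyBound.const 4).mul .size).add (.const 5)) fun m m' hm => ?_
    · exact (band PolyTime.snd.fst'.fst' PolyTime.snd.snd').pair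
        (cons (bxor PolyTime.snd.fst'.fst' PolyTime.snd.snd') PolyTime.snd.fst'.snd')
    · have h1 := hlen m' (true, [])
      have h2 := hm.length_le.trans (length_le_sz m)
      have h3 := hbits (m'.foldl incrementStep (true, [])).2
      have h4 := sz_bool_le (m'.foldl incrementStep (true, [])).1
      have h5 := sz_pair (m'.foldl incrementStep (true, [])).1 (m'.foldl incrementStep (true, [])).2
      simp only [List.length_nil, zero_add, Prod.mk.eta] at h1 h5
      omega
  have hinc : PolyTime inc :=
    (ite hfold.fst' (cons (const true) hfold.snd') hfold.snd').reverse
  have key : ∀ m : List β, m.foldl (fun acc _ => inc acc) [] = m.length.bits := by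
    intro m
    induction m using List.reverseRecOn with
    | nil => rfl
    | append_singleton m x ih =>
      rw [List.foldl_append, ih, List.length_append]
      exact increment_bits m.length []
  refine (foldl (s₀ := fun _ => []) (g := fun _ acc _ => inc acc) (b := fun a => 4 * sz (l a) + 1)
    hl (const []) (hinc.comp PolyTime.snd.fst') (((PolyBound.const 4).mul hl.size_bound).add
      (.const 1)) fun a m hm => ?_).of_eq fun a => (key _).symm
  rw [key]
  refine (hbits _).trans ?_
  have h1 : m.length.bits.length ≤ m.length := by
    rw [Nat.size_eq_bits_len, Nat.size_le]
    exact Nat.lt_two_pow_self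
  have h2 := hm.length_le.trans (length_le_sz _)
  omega

/-! ### Equality of values -/

theorem car {f : α → Val} (hf : PolyTime f) : PolyTime fun a => (f a).car :=
  comp (f := Val.car) ⟨.car, fun _ => 1, .const 1, PolyBound.size.mono fun v => by
    cases v with
    | nil => exact le_rfl
    | cons a b => change a.size ≤ a.size + b.size + 1; omega, fun v _ i => Exec.car v i⟩ hf

theorem cdr {f : α → Val} (hf : PolyTime f) : PolyTime fun a => (f a).cdr :=
  comp (f := Val.cdr) ⟨.cdr, fun _ => 1, .const 1, PolyBound.size.mono fun v => by
    cases v with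
    | nil => exact le_rfl
    | cons a b => change b.size ≤ a.size + b.size + 1; omega, fun v _ i => Exec.cdr v i⟩ hf

end PolyTime

/-- The value is not `nil`. -/
def Val.isCons : Val → Bool
  | .nil => false
  | .cons _ _ => true

namespace PolyTime

variable {α β γ δ : Type} [Enc α] [Enc β] [Enc γ] [Enc δ]

theorem isCons {f : α → Val} (hf : PolyTime f) : PolyTime fun a => (f a).isCons := by
  refine comp (f := Val.isCons) ⟨.ite .skip (.pair .nil .nil) .nil,
    fun v => if v.isCons then 5 else 3, (PolyBound.const 5).mono fun v => ?_,
    (PolyBound.const 3).mono fun v => sz_bool_le _, fun v ω i => ?_⟩ hf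
  · split_ifs <;> omega
  · cases v with
    | nil => exact .ite_false (.skip _ _) (.nil _ _)
    | cons a b =>
      exact .ite_true (.skip _ _) (fun h => Val.noConfusion h) (.pair (.nil _ _) (.nil _ _))

end PolyTime

/-- A step of the comparison of two trees. The state is a stack of pairs that have still to be
compared, and the verdict on the pairs seen so far. -/
def compareStep (s : List (Val × Val) × Bool) : List (Val × Val) × Bool :=
  match s.1 with
  | [] => s
  | p :: rest =>
    if p.1.isCons then
      if p.2.isCons then ((p.1.car, p.2.car) :: (p.1.cdr, p.2.cdr) :: rest, s.2) else ([], false)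
    else
      if p.2.isCons then ([], false) else (rest, s.2)

/-- The comparison ends with the right verdict after at most as many steps as the left trees on
the stack have nodes, and the state never grows. -/
theorem exists_compareStep_iterate (n : ℕ) (L : List (Val × Val)) (ok : Bool)
    (hn : (L.map fun p => p.1.size).sum ≤ n) :
    ∃ m ≤ n, (∀ j < m, (compareStep^[j] (L, ok)).1 ≠ []) ∧
      (compareStep^[m] (L, ok)).1 = [] ∧
      ((compareStep^[m] (L, ok)).2 = true ↔ ok = true ∧ ∀ p ∈ L, p.1 = p.2) ∧
      ∀ j ≤ m, sz (compareStep^[j] (L, ok)) ≤ sz (L, ok) := by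
  induction n generalizing L ok with
  | zero =>
    cases L with
    | nil => exact ⟨0, le_rfl, by simp, rfl, by simp, fun j hj => by simp [Nat.le_zero.1 hj]⟩
    | cons p L =>
      have := p.1.one_le_size
      simp only [List.map_cons, List.sum_cons] at hn
      omega
  | succ n ih =>
    cases L with
    | nil => exact ⟨0, by omega, by simp, rfl, by simp, fun j hj => by simp [Nat.le_zero.1 hj]⟩
    | cons p L =>
      obtain ⟨a, b⟩ := p
      simp only [List.map_cons, List.sum_cons] at hn
      suffices H : ∃ L' ok', compareStep ((a, b) :: L, ok) = (L', ok') ∧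
          (L'.map fun p => p.1.size).sum ≤ n ∧ sz (L', ok') ≤ sz ((a, b) :: L, ok) ∧
          ((ok' = true ∧ ∀ p ∈ L', p.1 = p.2) ↔ ok = true ∧ ∀ p ∈ (a, b) :: L, p.1 = p.2) by
        obtain ⟨L', ok', hstep, hn', hsz, hiff⟩ := H
        obtain ⟨m, hm, h1, h2, h3, h4⟩ := ih L' ok' hn'
        refine ⟨m + 1, by omega, fun j hj => ?_, ?_, ?_, fun j hj => ?_⟩
        · cases j with
          | zero => simp
          | succ j =>
            rw [Function.iterate_succ_apply, hstep]
            exact h1 j (by omega)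
        · rw [Function.iterate_succ_apply, hstep, h2]
        · rw [Function.iterate_succ_apply, hstep, h3, hiff]
        · cases j with
          | zero => simp
          | succ j =>
            rw [Function.iterate_succ_apply, hstep]
            exact (h4 j (by omega)).trans hsz
      have hsmall : sz (([] : List (Val × Val)), false) ≤ sz ((a, b) :: L, ok) := by
        have := one_le_sz ok
        have := one_le_sz (a, b)
        rw [sz_pair, sz_pair, sz_cons, sz_nil, show sz false = 1 from rfl]
        omega
      cases a with
      | nil =>
        have : Val.nil.size = 1 := rfl
        cases b with
        | nil => exact ⟨L, ok, rfl, by omega, by rw [sz_pair, sz_pair, sz_cons]; omega, by simp⟩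
        | cons b₁ b₂ => exact ⟨[], false, rfl, by simp, hsmall, by simp⟩
      | cons a₁ a₂ =>
        have ha : (Val.cons a₁ a₂).size = a₁.size + a₂.size + 1 := rfl
        cases b with
        | nil => exact ⟨[], false, rfl, by simp, hsmall, by simp⟩
        | cons b₁ b₂ =>
          refine ⟨(a₁, b₁) :: (a₂, b₂) :: L, ok, rfl, ?_, ?_, ?_⟩
          · simp only [List.map_cons, List.sum_cons]
            omega
          · have ha' : sz (Val.cons a₁ a₂) = sz a₁ + sz a₂ + 1 := rfl
            have hb' : sz (Val.cons b₁ b₂) = sz b₁ + sz b₂ + 1 := rfl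
            simp only [sz_pair, sz_cons]
            omega
          · simp [and_assoc]

namespace PolyTime

variable {α β γ δ : Type} [Enc α] [Enc β] [Enc γ] [Enc δ]

theorem compareStep : PolyTime ParamComplexity.compareStep := by
  refine (list_cases (α := List (Val × Val) × Bool) PolyTime.fst PolyTime.id (g := fun s p rest =>
    if p.1.isCons then
      if p.2.isCons then ((p.1.car, p.2.car) :: (p.1.cdr, p.2.cdr) :: rest, s.2) else ([], false)
    else
      if p.2.isCons then ([], false) else (rest, s.2)) ?_).of_eq fun s => by
    rcases s with ⟨_ | _, _⟩ <;> rfl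
  have h₁ : PolyTime fun q : (List (Val × Val) × Bool) × (Val × Val) × List (Val × Val) =>
      q.2.1.1 :=
    PolyTime.snd.fst'.fst'
  have h₂ : PolyTime fun q : (List (Val × Val) × Bool) × (Val × Val) × List (Val × Val) =>
      q.2.1.2 :=
    PolyTime.snd.fst'.snd'
  exact ite h₁.isCons
    (ite h₂.isCons
      (pair (cons (pair h₁.car h₂.car) (cons (pair h₁.cdr h₂.cdr) PolyTime.snd.snd'))
        PolyTime.fst.snd') (const _))
    (ite h₂.isCons (const _) (pair PolyTime.snd.snd' PolyTime.fst.snd'))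

theorem eq_val {f g : α → Val} [∀ a, Decidable (f a = g a)] (hf : PolyTime f) (hg : PolyTime g) :
    PolyTime fun a => decide (f a = g a) := by
  choose n hn h1 h2 h3 h4 using fun a =>
    exists_compareStep_iterate (f a).size [(f a, g a)] true (by simp)
  have h := loop (init := fun a => ([(f a, g a)], true)) (cont := fun s => !s.1.isEmpty)
    (n := n) (b := fun a => sz ([(f a, g a)], true))
    (pair (cons (pair hf hg) (const [])) (const true)) PolyTime.fst.isEmpty_not
    compareStep (hf.size_bound.mono hn)
    (pair (cons (pair hf hg) (const [])) (const true)).size_bound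
    (fun a m hm => by simpa using h1 a m hm) (fun a => by simp [h2 a]) (fun a m hm => h4 a m hm)
  refine h.snd'.of_eq fun a => ?_
  rw [Bool.eq_iff_iff, h3 a]
  simp

end PolyTime

/-! ### Injective encodings -/

/-- Distinct elements have distinct encodings. -/
class LawfulEnc (α : Type) [Enc α] : Prop where
  enc_injective : Function.Injective (enc : α → Val)

section LawfulEnc

variable {α β : Type} [Enc α] [Enc β]

instance : LawfulEnc Bool := ⟨fun a b h => by cases a <;> cases b <;> first | rfl | cases h⟩

instance [LawfulEnc α] [LawfulEnc β] : LawfulEnc (α × β) := ⟨fun p q h => by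
  rw [← Prod.mk.eta (p := p), ← Prod.mk.eta (p := q), enc_pair, enc_pair] at h
  injection h with h1 h2
  exact Prod.ext (LawfulEnc.enc_injective h1) (LawfulEnc.enc_injective h2)⟩

instance [LawfulEnc α] : LawfulEnc (List α) := ⟨fun l => by
  induction l with
  | nil =>
    intro m h
    cases m with
    | nil => rfl
    | cons b m => exact Val.noConfusion h
  | cons a l ih =>
    intro m h
    cases m with
    | nil => exact Val.noConfusion h
    | cons b m =>
      rw [enc_cons, enc_cons] at h
      injection h with h1 h2
      rw [LawfulEnc.enc_injective h1, ih h2]⟩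

instance : LawfulEnc ℕ := ⟨fun m n h => by
  have : sz m = sz n := congrArg Val.size h
  rw [sz_nat, sz_nat] at this
  omega⟩

theorem PolyTime.eq [LawfulEnc β] [DecidableEq β] {f g : α → β} (hf : PolyTime f)
    (hg : PolyTime g) : PolyTime fun a => decide (f a = g a) := by
  classical
  refine (PolyTime.eq_val (f := fun a => enc (f a)) (g := fun a => enc (g a))
    (hf.of_enc_eq fun _ => rfl) (hg.of_enc_eq fun _ => rfl)).of_eq fun a => ?_
  exact decide_eq_decide.2 LawfulEnc.enc_injective.eq_iff.symm

theorem PolyTime.mem [LawfulEnc β] [DecidableEq β] {f : α → β} {l : α → List β}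
    (hf : PolyTime f) (hl : PolyTime l) : PolyTime fun a => decide (f a ∈ l a) :=
  (PolyTime.any (p := fun a b => decide (f a = b)) hl
    (PolyTime.eq (hf.comp PolyTime.fst) PolyTime.snd)).of_eq fun a => by
      rw [Bool.eq_iff_iff]
      simp

end LawfulEnc

/-! ### The lattice of a constraint satisfaction problem -/

/-- An edge: its endpoints and the truth table of its constraint. -/
abbrev Edge := ℕ × ℕ × List (List Bool)

/-- A choice for an edge: a symbol for each endpoint. -/
abbrev Choice := Edge × ℕ × ℕ

/-- The numbers of vertices and of symbols, and the edges. -/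
abbrev RawCSP := ℕ × ℕ × List Edge

/-- The variables of the lattice problem at a node of the tree of sequences of choices, where the
latest choice stands first. The variable `(π, [])` is the weight of the node `π`, and
`(π, [(v, a)])` is the weight that the children of `π` give to the symbol `a` at the vertex `v`. -/
abbrev Var := List Choice × List (ℕ × ℕ)

instance : DecidableEq Choice := inferInstance

instance : DecidableEq Var := inferInstance

/-- A row `(b, L, d)` of the lattice problem is the linear form "sum of the variables in `L` minus
`d`", which is an equation to be enforced if `b` is true. For false `b`, the list `L` is `[d]`, and
the row is the single variable `d` (see `entry`). -/
abbrev Row := Bool × List Var × Var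

/-- The truth table `R` allows the symbols `a` and `b`. -/
def lookup (R : List (List Bool)) (a b : ℕ) : Bool := (R.getD a []).getD b false

/-- The choices for the edge `e` that satisfy its constraint. -/
def allowed (s : ℕ) (e : Edge) : List Choice :=
  (List.range s).flatMap fun a => (List.range s).flatMap fun b =>
    if lookup e.2.2 a b then [(e, a, b)] else []

/-- The satisfying choices for all edges. -/
def choices (G : RawCSP) : List Choice := G.2.2.flatMap (allowed G.2.1)

/-- The sequences of length `j` over `L`. -/
def tuples {α : Type} (L : List α) : ℕ → List (List α)
  | 0 => [[]]
  | j + 1 => (tuples L j).flatMap fun π => L.map fun c => c :: π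

/-- The sequences of length less than `j` over `L`. -/
def tuplesLT {α : Type} (L : List α) : ℕ → List (List α)
  | 0 => []
  | j + 1 => tuplesLT L j ++ tuples L j

/-- The equations at a node of the tree: the weights of the children in the first component sum up
to the weight of the node if the second component is `[]`, and to the weight of the symbol `a` at
the vertex `v` if it is `[(v, a)]`. -/
def equations (G : RawCSP) : List (List Choice × List (ℕ × ℕ)) :=
  G.2.2.flatMap fun e => (allowed G.2.1 e, []) :: (List.range G.2.1).flatMap fun a =>
    [((allowed G.2.1 e).filter fun c => decide (c.2.1 = a), [(e.1, a)]),
      ((allowed G.2.1 e).filter fun c => decide (c.2.2 = a), [(e.2.1, a)])]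

/-- The columns of the lattice basis. The weight `([], [])` of the root is not among them: it is
the multiplier of the target vector. -/
def columns (G : RawCSP) (r : ℕ) : List Var :=
  ((tuplesLT (choices G) r).flatMap fun π => (List.range G.1).flatMap fun v =>
      (List.range G.2.1).map fun a => (π, [(v, a)])) ++
    (tuplesLT (choices G) r).flatMap fun π => (choices G).map fun c => (c :: π, [])

/-- The row of the equation `q` at the node `π`. -/
def equationRow (π : List Choice) (q : List Choice × List (ℕ × ℕ)) : Row :=
  (true, q.1.map fun c => (c :: π, []), (π, q.2))

/-- The row of the weight of the leaf `π`. -/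
def weightRow (π : List Choice) : Row := (false, [(π, [])], (π, []))

/-- The equations at all inner nodes of the tree of depth `r`, and the weights of its leaves. -/
def rows (G : RawCSP) (r : ℕ) : List Row :=
  ((tuplesLT (choices G) r).flatMap fun π => (equations G).map fun q => equationRow π q) ++
    (tuples (choices G) r).map weightRow

/-- The matrix entry in the row `ρ` and the column `d`. Equations are scaled by `M`, so that it does
not pay to violate one. -/
def entry (M : ℕ) (ρ : Row) (d : Var) : ℤ :=
  if d ∈ ρ.2.1 then (if ρ.1 then (M : ℤ) else 1)
  else if d = ρ.2.2 then (if ρ.1 then -(M : ℤ) else -1) else 0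

/-- The entry of the target vector in the row `ρ`: the negative of the coefficient that the weight
of the root would have if it were a column. -/
def target (M : ℕ) (ρ : Row) : ℤ :=
  if ρ.2.2 = ([], []) then (if ρ.1 then (M : ℤ) else 1) else 0

/-- The threshold: the weight of an assignment that satisfies all edges. -/
def threshold (G : RawCSP) (r : ℕ) : ℕ := G.2.2.length ^ r

/-- A power of two, which is easy to write in binary, above `2 ^ g` times the threshold. -/
def scale (G : RawCSP) (r g : ℕ) : ℕ := 2 ^ (threshold G r + g)

theorem length_tuples {α : Type} (L : List α) (j : ℕ) : (tuples L j).length = L.length ^ j := by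
  induction j with
  | zero => rfl
  | succ j ih => simp [tuples, List.length_flatMap, ih, pow_succ]

/-! ### The lattice is computable in polynomial time -/

namespace PolyTime

variable {α β : Type} [Enc α] [Enc β]

theorem lookup {R : α → List (List Bool)} {f g : α → ℕ} (hR : PolyTime R) (hf : PolyTime f)
    (hg : PolyTime g) : PolyTime fun a => lookup (R a) (f a) (g a) :=
  getD false (getD [] hR hf) hg

theorem allowed {s : α → ℕ} {e : α → Edge} (hs : PolyTime s) (he : PolyTime e) :
    PolyTime fun a => allowed (s a) (e a) :=
  flatMap hs.range <| flatMap (hs.comp .fst).range <|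
    ite (lookup (he.comp (.fst' .fst)).snd'.snd' (.snd' .fst) .snd)
      (cons (pair (he.comp (.fst' .fst)) (pair (.snd' .fst) .snd)) (const [])) (const [])

theorem choices : PolyTime choices :=
  flatMap PolyTime.snd.snd' (allowed PolyTime.fst.snd'.fst' .snd)

theorem tuples {L : α → List β} (hL : PolyTime L) (j : ℕ) : PolyTime fun a => tuples (L a) j := by
  induction j with
  | zero => exact const _
  | succ j ih => exact flatMap ih (map (hL.comp .fst) (cons .snd (.snd' .fst)))

theorem tuplesLT {L : α → List β} (hL : PolyTime L) (j : ℕ) :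
    PolyTime fun a => tuplesLT (L a) j := by
  induction j with
  | zero => exact const _
  | succ j ih => exact append ih (tuples hL j)

theorem equations : PolyTime equations := by
  refine flatMap PolyTime.snd.snd' (cons (pair (allowed PolyTime.fst.snd'.fst' .snd) (const [])) ?_)
  refine flatMap (range PolyTime.fst.snd'.fst') ?_
  have h : PolyTime fun p : (RawCSP × Edge) × ℕ => ParamComplexity.allowed p.1.1.2.1 p.1.2 :=
    allowed PolyTime.fst.fst'.snd'.fst' PolyTime.fst.snd'
  exact cons (pair (filter h (eq PolyTime.snd.snd'.fst' PolyTime.fst.snd'))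
      (cons (pair PolyTime.fst.snd'.fst' .snd) (const [])))
    (cons (pair (filter h (eq PolyTime.snd.snd'.snd' PolyTime.fst.snd'))
      (cons (pair PolyTime.fst.snd'.snd'.fst' .snd) (const []))) (const []))

theorem columns (r : ℕ) : PolyTime fun G => columns G r :=
  append
    (flatMap (tuplesLT choices r) <| flatMap (range PolyTime.fst.fst') <|
      map (range PolyTime.fst.fst'.snd'.fst') <|
        pair PolyTime.fst.fst'.snd' (cons (pair PolyTime.fst.snd' .snd) (const [])))
    (flatMap (tuplesLT choices r) <| map (choices.comp .fst) <|
      pair (cons .snd PolyTime.fst.snd') (const []))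

theorem rows (r : ℕ) : PolyTime fun G => rows G r :=
  append
    (flatMap (tuplesLT choices r) <| map (equations.comp .fst) <|
      pair (const true) <| pair
        (map PolyTime.snd.fst' (pair (cons .snd PolyTime.fst.fst'.snd') (const [])))
        (pair PolyTime.fst.snd' PolyTime.snd.snd'))
    (map (tuples choices r) <| pair (const false) <|
      pair (cons (pair .snd (const [])) (const [])) (pair .snd (const [])))

theorem threshold (r : ℕ) : PolyTime fun G => (threshold G r).bits :=
  (length_bits (tuples PolyTime.snd.snd' r)).of_eq fun G => by
    rw [length_tuples, ParamComplexity.threshold]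

theorem scale_bits (r g : ℕ) : PolyTime fun G => (scale G r g).bits := by
  have key : ∀ n, (2 ^ n).bits = List.replicate n false ++ [true] := by
    intro n
    induction n with
    | zero => simp
    | succ n ih =>
      rw [pow_succ, mul_comm, ← Nat.bit_false_apply, Nat.bits_append_bit _ _ (by simp), ih]
      rfl
  refine (append (map (f := fun _ _ => false) (tuples PolyTime.snd.snd' r) (const false))
    (const (List.replicate g false ++ [true]))).of_eq fun G => ?_
  rw [scale, key, List.map_const', length_tuples, ← List.append_assoc,
    List.replicate_append_replicate, ParamComplexity.threshold]

theorem scale (r g : ℕ) : PolyTime fun G => (scale G r g : ℤ) :=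
  (pair (const false) (scale_bits r g)).of_enc_eq fun _ => rfl

theorem neg_scale (r g : ℕ) : PolyTime fun G => -(ParamComplexity.scale G r g : ℤ) :=
  (pair (const true) (scale_bits r g)).of_enc_eq fun G => by
    change Val.ofInt _ = Val.cons (Val.ofBool true) (Val.binary _)
    have : 0 < ParamComplexity.scale G r g := by rw [ParamComplexity.scale]; positivity
    rw [Val.ofInt, Int.natAbs_neg, Int.natAbs_natCast, decide_eq_true (by omega)]

theorem entry (r g : ℕ) :
    PolyTime fun p : (RawCSP × Row) × Var => entry (ParamComplexity.scale p.1.1 r g) p.1.2 p.2 := by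
  have hb : PolyTime fun p : (RawCSP × Row) × Var => p.1.2.1 := PolyTime.fst.snd'.fst'
  refine (ite (mem .snd PolyTime.fst.snd'.snd'.fst')
    (ite hb ((scale r g).comp PolyTime.fst.fst') (const 1))
    (ite (eq .snd PolyTime.fst.snd'.snd'.snd')
      (ite hb ((neg_scale r g).comp PolyTime.fst.fst') (const (-1))) (const 0))).of_eq fun p => ?_
  simp only [ParamComplexity.entry, decide_eq_true_eq]

theorem target (r g : ℕ) :
    PolyTime fun p : RawCSP × Row => target (ParamComplexity.scale p.1 r g) p.2 := by
  refine (ite (eq PolyTime.snd.snd'.snd' (const ([], [])))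
    (ite PolyTime.snd.fst' ((scale r g).comp .fst) (const 1)) (const 0)).of_eq fun p => ?_
  simp only [ParamComplexity.target, decide_eq_true_eq]

/-- The matrix, the target vector and the threshold, for inputs in the form `RawCSP`. -/
theorem lattice (r g : ℕ) : PolyTime fun G =>
    ((ParamComplexity.rows G r).map fun ρ =>
        (ParamComplexity.columns G r).map (ParamComplexity.entry (ParamComplexity.scale G r g) ρ),
      (ParamComplexity.rows G r).map (ParamComplexity.target (ParamComplexity.scale G r g)),
      (ParamComplexity.threshold G r).bits) :=
  pair (map (rows r) (map ((columns r).comp .fst) (entry r g)))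
    (pair (map (rows r) (target r g)) (threshold r))

end PolyTime

/-! ### Sums and counts over lists -/

theorem nodup_flatMap_of_leftInverse {α β : Type} {l : List α} {f : α → List β} (g : β → α)
    (hl : l.Nodup) (hf : ∀ a ∈ l, (f a).Nodup) (hg : ∀ a ∈ l, ∀ b ∈ f a, g b = a) :
    (l.flatMap f).Nodup := by
  rw [List.nodup_flatMap]
  refine ⟨hf, hl.imp_of_mem fun ha hb hne => ?_⟩
  rw [Function.onFun, List.disjoint_left]
  exact fun c hc hc' => hne ((hg _ ha c hc).symm.trans (hg _ hb c hc'))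

theorem sum_map_filter_ne_zero {α : Type} (l : List α) (f : α → ℤ) :
    ((l.filter fun a => decide (f a ≠ 0)).map f).sum = (l.map f).sum := by
  induction l with
  | nil => rfl
  | cons a l ih =>
    rw [List.filter_cons]
    by_cases h : f a = 0 <;> simp [h, ← ih]

theorem sum_map_ite_one {α : Type} (l : List α) (p : α → Bool) :
    (l.map fun a => if p a then (1 : ℤ) else 0).sum = l.countP p := by
  induction l with
  | nil => rfl
  | cons a l ih => rw [List.map_cons, List.sum_cons, ih, List.countP_cons]; push_cast; ring_nf

/-! ### The tree of choices -/

theorem mem_allowed {s : ℕ} {e : Edge} {c : Choice} :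
    c ∈ allowed s e ↔ c.1 = e ∧ c.2.1 < s ∧ c.2.2 < s ∧ lookup e.2.2 c.2.1 c.2.2 = true := by
  obtain ⟨e', a, b⟩ := c
  simp only [allowed, List.mem_flatMap, List.mem_range]
  constructor
  · rintro ⟨a', ha', b', hb', h⟩
    split_ifs at h with hl
    · simp only [List.mem_singleton, Prod.mk.injEq] at h
      obtain ⟨rfl, rfl, rfl⟩ := h
      exact ⟨rfl, ha', hb', hl⟩
    · simp at h
  · rintro ⟨rfl, ha, hb, h⟩
    exact ⟨a, ha, b, hb, by simp [h]⟩

theorem nodup_allowed (s : ℕ) (e : Edge) : (allowed s e).Nodup := by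
  refine nodup_flatMap_of_leftInverse (fun c => c.2.1) List.nodup_range (fun a _ => ?_) ?_
  · refine nodup_flatMap_of_leftInverse (fun c => c.2.2) List.nodup_range (fun b _ => ?_) ?_
    · split_ifs <;> simp
    · intro b _ c hc
      split_ifs at hc
      · rw [List.mem_singleton.1 hc]
      · simp at hc
  · intro a _ c hc
    obtain ⟨b, _, hc⟩ := List.mem_flatMap.1 hc
    split_ifs at hc
    · rw [List.mem_singleton.1 hc]
    · simp at hc

theorem nodup_choices {G : RawCSP} (hG : G.2.2.Nodup) : (choices G).Nodup :=
  nodup_flatMap_of_leftInverse (fun c => c.1) hG (fun _ _ => nodup_allowed _ _)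
    fun _ _ _ hc => (mem_allowed.1 hc).1

theorem mem_tuples {α : Type} {L : List α} {j : ℕ} {π : List α} :
    π ∈ tuples L j ↔ π.length = j ∧ ∀ c ∈ π, c ∈ L := by
  induction j generalizing π with
  | zero =>
    rw [tuples, List.mem_singleton, List.length_eq_zero_iff]
    exact ⟨fun h => ⟨h, by simp [h]⟩, fun h => h.1⟩
  | succ j ih =>
    simp only [tuples, List.mem_flatMap, List.mem_map, ih]
    cases π with
    | nil => simp
    | cons c π => simp; tauto

theorem mem_tuplesLT {α : Type} {L : List α} {j : ℕ} {π : List α} :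
    π ∈ tuplesLT L j ↔ π.length < j ∧ ∀ c ∈ π, c ∈ L := by
  induction j with
  | zero => simp [tuplesLT]
  | succ j ih =>
    rw [tuplesLT, List.mem_append, ih, mem_tuples, ← or_and_right, Nat.lt_succ_iff_lt_or_eq]

theorem nodup_tuples {α : Type} {L : List α} (hL : L.Nodup) (j : ℕ) : (tuples L j).Nodup := by
  induction j with
  | zero => simp [tuples]
  | succ j ih =>
    refine nodup_flatMap_of_leftInverse List.tail ih
      (fun π _ => hL.map fun _ _ h => (List.cons.inj h).1) fun π _ τ hτ => ?_
    obtain ⟨c, _, rfl⟩ := List.mem_map.1 hτ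
    rfl

theorem nodup_tuplesLT {α : Type} {L : List α} (hL : L.Nodup) (j : ℕ) : (tuplesLT L j).Nodup := by
  induction j with
  | zero => simp [tuplesLT]
  | succ j ih =>
    rw [tuplesLT, List.nodup_append']
    refine ⟨ih, nodup_tuples hL j, List.disjoint_left.2 fun π h h' => ?_⟩
    have := (mem_tuplesLT.1 h).1
    have := (mem_tuples.1 h').1
    omega

theorem mem_columns {G : RawCSP} {r : ℕ} {d : Var} : d ∈ columns G r ↔
    (∃ π ∈ tuplesLT (choices G) r, ∃ v < G.1, ∃ a < G.2.1, d = (π, [(v, a)])) ∨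
      ∃ π ∈ tuplesLT (choices G) r, ∃ c ∈ choices G, d = (c :: π, []) := by
  simp only [columns, List.mem_append, List.mem_flatMap, List.mem_map, List.mem_range, eq_comm]

theorem nodup_columns {G : RawCSP} (hG : G.2.2.Nodup) (r : ℕ) : (columns G r).Nodup := by
  have h := nodup_tuplesLT (nodup_choices hG) r
  rw [columns, List.nodup_append']
  refine ⟨?_, ?_, List.disjoint_left.2 fun d hd hd' => ?_⟩
  · refine nodup_flatMap_of_leftInverse Prod.fst h (fun π _ => ?_) ?_
    · refine nodup_flatMap_of_leftInverse (fun d => (d.2.headD (0, 0)).1) List.nodup_range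
        (fun v _ => List.nodup_range.map fun a b hab => ?_) ?_
      · simpa using hab
      · intro v _ d hd
        obtain ⟨a, _, rfl⟩ := List.mem_map.1 hd
        rfl
    · intro π _ d hd
      obtain ⟨v, _, hd⟩ := List.mem_flatMap.1 hd
      obtain ⟨a, _, rfl⟩ := List.mem_map.1 hd
      rfl
  · refine nodup_flatMap_of_leftInverse (fun d => d.1.tail) h
      (fun π _ => (nodup_choices hG).map fun a b hab => ?_) ?_
    · simpa using hab
    · intro π _ d hd
      obtain ⟨c, _, rfl⟩ := List.mem_map.1 hd
      rfl
  · simp only [List.mem_flatMap, List.mem_map] at hd hd'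
    obtain ⟨π, _, v, _, a, _, rfl⟩ := hd
    obtain ⟨π, _, c, _, h⟩ := hd'
    simp at h

theorem mem_equations {G : RawCSP} {q : List Choice × List (ℕ × ℕ)} : q ∈ equations G ↔
    ∃ e ∈ G.2.2, q = (allowed G.2.1 e, []) ∨ ∃ a < G.2.1,
      q = ((allowed G.2.1 e).filter fun c => decide (c.2.1 = a), [(e.1, a)]) ∨
      q = ((allowed G.2.1 e).filter fun c => decide (c.2.2 = a), [(e.2.1, a)]) := by
  simp only [equations, List.mem_flatMap, List.mem_cons, List.mem_range, List.not_mem_nil, or_false]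

theorem equations_subset {G : RawCSP} {q : List Choice × List (ℕ × ℕ)} (hq : q ∈ equations G) :
    q.1.Nodup ∧ ∀ c ∈ q.1, c ∈ choices G := by
  obtain ⟨e, he, h⟩ := mem_equations.1 hq
  have hc : ∀ c ∈ allowed G.2.1 e, c ∈ choices G := fun c hc => List.mem_flatMap.2 ⟨e, he, hc⟩
  rcases h with rfl | ⟨a, _, rfl | rfl⟩
  · exact ⟨nodup_allowed _ _, hc⟩
  · exact ⟨(nodup_allowed _ _).filter _, fun c h => hc c (List.mem_filter.1 h).1⟩
  · exact ⟨(nodup_allowed _ _).filter _, fun c h => hc c (List.mem_filter.1 h).1⟩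

/-! ### The rows as linear forms -/

/-- The coordinate for the row `ρ` of the difference between the lattice vector with coefficients
`X` and the multiple of the target vector by the weight of the root. -/
def rowValue (G : RawCSP) (r M : ℕ) (ρ : Row) (X : Var → ℤ) : ℤ :=
  ((columns G r).map fun d => entry M ρ d * X d).sum - X ([], []) * target M ρ

theorem sum_entry {cols : List Var} (hcols : cols.Nodup) {ρ : Row} (hρ : ρ.2.1.Nodup)
    (hsub : ∀ d ∈ ρ.2.1, d ∈ cols) (M : ℕ) (X : Var → ℤ) :
    (cols.map fun d => entry M ρ d * X d).sum =
      (if ρ.1 then (M : ℤ) else 1) * ((ρ.2.1.map X).sum -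
        if ρ.2.2 ∈ cols ∧ ρ.2.2 ∉ ρ.2.1 then X ρ.2.2 else 0) := by
  set m : ℤ := if ρ.1 then (M : ℤ) else 1 with hm
  have hentry : ∀ d, entry M ρ d * X d =
      m * ((if d ∈ ρ.2.1 then X d else 0) - if d = ρ.2.2 then
        (if ρ.2.2 ∉ ρ.2.1 then X ρ.2.2 else 0) else 0) := by
    intro d
    rw [entry]
    by_cases h1 : d ∈ ρ.2.1
    · by_cases h2 : d = ρ.2.2
      · subst h2; simp [h1, hm]
      · simp [h1, h2, hm]
    · by_cases h2 : d = ρ.2.2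
      · subst h2
        rw [hm]
        cases ρ.1 <;> simp [h1]
      · simp [h1, h2]
  simp_rw [hentry]
  rw [← List.sum_toFinset _ hcols, ← List.sum_toFinset _ hρ, ← Finset.mul_sum,
    Finset.sum_sub_distrib, Finset.sum_ite_eq', ← Finset.sum_filter]
  have : cols.toFinset.filter (fun d => d ∈ ρ.2.1) = ρ.2.1.toFinset := by
    ext d
    simpa using hsub d
  rw [this]
  simp only [List.mem_toFinset, ite_and]

theorem rowValue_equationRow {G : RawCSP} (hG : G.2.2.Nodup)
    (hv : ∀ e ∈ G.2.2, e.1 < G.1 ∧ e.2.1 < G.1) {r : ℕ} (M : ℕ) {π : List Choice}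
    (hπ : π ∈ tuplesLT (choices G) r) {q : List Choice × List (ℕ × ℕ)} (hq : q ∈ equations G)
    (X : Var → ℤ) : rowValue G r M (equationRow π q) X =
      M * ((q.1.map fun c => X (c :: π, [])).sum - X (π, q.2)) := by
  obtain ⟨hn, hsub⟩ := equations_subset hq
  have hnot : (π, q.2) ∉ q.1.map fun c => ((c :: π, []) : Var) := fun h => by
    obtain ⟨c, _, h⟩ := List.mem_map.1 h
    have := congrArg (fun d : Var => d.1.length) h
    simp at this
  rw [rowValue, sum_entry (nodup_columns hG r) (hn.map fun a b h => by simpa using h) (by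
    intro d hd
    obtain ⟨c, hc, rfl⟩ := List.mem_map.1 hd
    exact mem_columns.2 (.inr ⟨π, hπ, c, hsub c hc, rfl⟩))]
  simp only [equationRow, target, List.map_map, hnot, not_false_eq_true, and_true, if_true]
  by_cases hroot : ((π, q.2) : Var) = ([], [])
  · have hcol : ((([], []) : Var)) ∉ columns G r := fun h => by
      rcases mem_columns.1 h with ⟨_, _, _, _, _, _, h⟩ | ⟨_, _, _, _, h⟩ <;> simp at h
    rw [hroot, if_neg hcol, if_pos rfl]
    simp only [Function.comp_def]
    ring
  · have hcol : (π, q.2) ∈ columns G r := by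
      rw [mem_columns]
      obtain ⟨e, he, h⟩ := mem_equations.1 hq
      rcases h with rfl | ⟨a, ha, rfl | rfl⟩
      · cases π with
        | nil => exact absurd rfl hroot
        | cons c τ =>
          have := mem_tuplesLT.1 hπ
          refine .inr ⟨τ, mem_tuplesLT.2 ⟨?_, fun d hd => this.2 d (List.mem_cons_of_mem _ hd)⟩, c,
            this.2 c List.mem_cons_self, rfl⟩
          exact lt_trans (Nat.lt_succ_self _) this.1
      · exact .inl ⟨π, hπ, e.1, (hv e he).1, a, ha, rfl⟩
      · exact .inl ⟨π, hπ, e.2.1, (hv e he).2, a, ha, rfl⟩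
    rw [if_pos hcol, if_neg hroot]
    simp only [Function.comp_def]
    ring

theorem rowValue_weightRow {G : RawCSP} (hG : G.2.2.Nodup) {r : ℕ} (hr : 0 < r) (M : ℕ)
    {π : List Choice} (hπ : π ∈ tuples (choices G) r) (X : Var → ℤ) :
    rowValue G r M (weightRow π) X = X (π, []) := by
  obtain ⟨hlen, hsub⟩ := mem_tuples.1 hπ
  cases π with
  | nil => simp at hlen; omega
  | cons c τ =>
    have hcol : ((c :: τ, []) : Var) ∈ columns G r :=
      mem_columns.2 (.inr ⟨τ, mem_tuplesLT.2 ⟨by rw [← hlen]; simp, fun d hd =>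
        hsub d (List.mem_cons_of_mem _ hd)⟩, c, hsub c List.mem_cons_self, rfl⟩)
    rw [rowValue, sum_entry (nodup_columns hG r) (by simp [weightRow]) (by simpa [weightRow])]
    simp [weightRow, target]

/-! ### Completeness -/

section Completeness

variable {G : RawCSP} {ψ : ℕ → ℕ}

/-- The choice follows the assignment `ψ`. -/
def agrees (ψ : ℕ → ℕ) (c : Choice) : Bool := decide (c.2.1 = ψ c.1.1 ∧ c.2.2 = ψ c.1.2.1)

/-- The weights that an assignment induces: `1` for the sequences of choices that follow it. -/
def assignmentWeight (ψ : ℕ → ℕ) (d : Var) : ℤ :=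
  if d.1.all (agrees ψ) && d.2.all (fun p => decide (ψ p.1 = p.2)) then 1 else 0

theorem filter_agrees_allowed (hψ : ∀ v, ψ v < G.2.1) {e : Edge}
    (he : lookup e.2.2 (ψ e.1) (ψ e.2.1) = true) :
    (allowed G.2.1 e).filter (agrees ψ) = [(e, ψ e.1, ψ e.2.1)] := by
  refine List.perm_singleton.1 ((List.perm_ext_iff_of_nodup ((nodup_allowed _ _).filter _)
    (List.nodup_singleton _)).2 fun c => ?_)
  obtain ⟨e', a, b⟩ := c
  simp only [List.mem_filter, mem_allowed, agrees, decide_eq_true_eq, List.mem_singleton,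
    Prod.mk.injEq]
  constructor
  · rintro ⟨⟨rfl, _⟩, h1, h2⟩
    exact ⟨rfl, h1, h2⟩
  · rintro ⟨rfl, rfl, rfl⟩
    exact ⟨⟨rfl, hψ _, hψ _, he⟩, rfl, rfl⟩

theorem assignmentWeight_cons (c : Choice) (π : List Choice) :
    assignmentWeight ψ (c :: π, []) = if π.all (agrees ψ) && agrees ψ c then 1 else 0 := by
  simp only [assignmentWeight, List.all_cons, List.all_nil, Bool.and_true,
    Bool.and_comm (agrees ψ c)]

theorem assignmentWeight_equation (hψ : ∀ v, ψ v < G.2.1)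
    (hsat : ∀ e ∈ G.2.2, lookup e.2.2 (ψ e.1) (ψ e.2.1) = true) (π : List Choice)
    {q : List Choice × List (ℕ × ℕ)} (hq : q ∈ equations G) :
    (q.1.map fun c => assignmentWeight ψ (c :: π, [])).sum = assignmentWeight ψ (π, q.2) := by
  simp_rw [assignmentWeight_cons, sum_map_ite_one]
  by_cases hπ : π.all (agrees ψ) = true
  · simp only [assignmentWeight, hπ, Bool.true_and, List.countP_eq_length_filter]
    obtain ⟨e, he, h⟩ := mem_equations.1 hq
    have hf := filter_agrees_allowed hψ (hsat e he)
    rcases h with rfl | ⟨a, ha, rfl | rfl⟩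
    · rw [hf]; rfl
    · rw [List.filter_filter]
      simp_rw [Bool.and_comm (agrees ψ _)]
      rw [← List.filter_filter, hf]
      by_cases h : ψ e.1 = a <;> simp [h]
    · rw [List.filter_filter]
      simp_rw [Bool.and_comm (agrees ψ _)]
      rw [← List.filter_filter, hf]
      by_cases h : ψ e.2.1 = a <;> simp [h]
  · simp [assignmentWeight, hπ]

theorem countP_agrees_tuples (hψ : ∀ v, ψ v < G.2.1)
    (hsat : ∀ e ∈ G.2.2, lookup e.2.2 (ψ e.1) (ψ e.2.1) = true) (j : ℕ) :
    (tuples (choices G) j).countP (fun π => π.all (agrees ψ)) = G.2.2.length ^ j := by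
  have hC : (choices G).countP (agrees ψ) = G.2.2.length := by
    rw [choices, List.countP_flatMap, List.map_congr_left (g := fun _ => 1) fun e he => by
      simp [List.countP_eq_length_filter, filter_agrees_allowed hψ (hsat e he)]]
    simp
  induction j with
  | zero => simp [tuples]
  | succ j ih =>
    have : ∀ π : List Choice, ((choices G).map fun c => c :: π).countP (fun π => π.all (agrees ψ)) =
        G.2.2.length * if π.all (agrees ψ) then 1 else 0 := by
      intro π
      rw [List.countP_map, ← hC]
      by_cases hπ : π.all (agrees ψ) = true <;> simp [Function.comp_def, hπ]
    rw [tuples, List.countP_flatMap]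
    simp only [Function.comp_def, this]
    rw [List.sum_map_mul_left, pow_succ, ← ih, mul_comm]
    congr 1
    have := sum_map_ite_one (tuples (choices G) j) (fun π => π.all (agrees ψ))
    zify
    rw [← this]
    simp [Function.comp_def]

end Completeness

/-! ### Soundness -/

section Soundness

variable {G : RawCSP} {ε : ℝ}

/-- An edge with exactly one nonzero choice determines the symbols at its endpoints, so that the
edges violated by any assignment read off from the weights have two nonzero choices. -/
theorem le_countP_choices (hs : 0 < G.2.1)
    (hunsat : ∀ ψ : ℕ → ℕ, (∀ v, ψ v < G.2.1) →
      ε * G.2.2.length ≤ G.2.2.countP fun e => !lookup e.2.2 (ψ e.1) (ψ e.2.1))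
    (x : Choice → ℤ) (y : List (ℕ × ℕ) → ℤ) (hy : y [] ≠ 0)
    (heq : ∀ q ∈ equations G, (q.1.map x).sum = y q.2) :
    (1 + ε) * G.2.2.length ≤ (choices G).countP fun c => decide (x c ≠ 0) := by
  have hex : ∀ v, ∃ a < G.2.1, (∃ b < G.2.1, y [(v, b)] ≠ 0) → y [(v, a)] ≠ 0 := by
    intro v
    by_cases h : ∃ b < G.2.1, y [(v, b)] ≠ 0
    · obtain ⟨b, hb, hb'⟩ := h
      exact ⟨b, hb, fun _ => hb'⟩
    · exact ⟨0, hs, fun h' => absurd h' h⟩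
  choose ψ hψ hψy using hex
  have key : ∀ e ∈ G.2.2, 1 + (if !lookup e.2.2 (ψ e.1) (ψ e.2.1) then 1 else 0) ≤
      (allowed G.2.1 e).countP fun c => decide (x c ≠ 0) := by
    intro e he
    have hsum := heq _ (mem_equations.2 ⟨e, he, .inl rfl⟩)
    by_contra! hlt
    rw [List.countP_eq_length_filter] at hlt
    have hpos : 0 < ((allowed G.2.1 e).filter fun c => decide (x c ≠ 0)).length := by
      rw [List.length_pos_iff]
      intro h0
      rw [← sum_map_filter_ne_zero, h0] at hsum
      exact hy hsum.symm
    have hsat : lookup e.2.2 (ψ e.1) (ψ e.2.1) = false := by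
      by_contra h
      rw [Bool.not_eq_false] at h
      rw [h, Bool.not_true, if_neg Bool.false_ne_true] at hlt
      omega
    have hone : ((allowed G.2.1 e).filter fun c => decide (x c ≠ 0)).length = 1 := by
      rw [hsat, Bool.not_false, if_pos rfl] at hlt
      omega
    obtain ⟨c, hc⟩ := List.length_eq_one_iff.1 hone
    have hmem : c ∈ (allowed G.2.1 e).filter fun c => decide (x c ≠ 0) := by
      rw [hc]; exact List.mem_singleton_self c
    obtain ⟨hc1, hc2⟩ := List.mem_filter.1 hmem
    obtain ⟨hce, ha, hb, hl⟩ := mem_allowed.1 hc1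
    have hxc : x c ≠ 0 := by simpa using hc2
    have hfilter : ∀ p : Choice → Bool,
        (((allowed G.2.1 e).filter p).map x).sum = if p c then x c else 0 := by
      intro p
      rw [← sum_map_filter_ne_zero, List.filter_filter]
      simp_rw [Bool.and_comm _ (p _)]
      rw [← List.filter_filter, hc]
      cases h : p c <;> simp [h]
    have hu : c.2.1 = ψ e.1 := by
      have h1 : ∀ a < G.2.1, y [(e.1, a)] = if c.2.1 = a then x c else 0 := fun a ha => by
        rw [← heq _ (mem_equations.2 ⟨e, he, .inr ⟨a, ha, .inl rfl⟩⟩), hfilter]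
        simp
      have h2 := hψy e.1 ⟨c.2.1, ha, by rw [h1 _ ha]; simpa using hxc⟩
      rw [h1 _ (hψ _)] at h2
      exact (ite_ne_right_iff.1 h2).1
    have hv : c.2.2 = ψ e.2.1 := by
      have h1 : ∀ a < G.2.1, y [(e.2.1, a)] = if c.2.2 = a then x c else 0 := fun a ha => by
        rw [← heq _ (mem_equations.2 ⟨e, he, .inr ⟨a, ha, .inr rfl⟩⟩), hfilter]
        simp
      have h2 := hψy e.2.1 ⟨c.2.2, hb, by rw [h1 _ hb]; simpa using hxc⟩
      rw [h1 _ (hψ _)] at h2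
      exact (ite_ne_right_iff.1 h2).1
    rw [hu, hv, hsat] at hl
    exact Bool.noConfusion hl
  have hcount : G.2.2.length + G.2.2.countP (fun e => !lookup e.2.2 (ψ e.1) (ψ e.2.1)) ≤
      (choices G).countP fun c => decide (x c ≠ 0) := by
    rw [choices, List.countP_flatMap]
    refine le_trans (le_of_eq ?_) (List.sum_le_sum key)
    rw [List.sum_map_add]
    congr 1
    · simp
    · have := sum_map_ite_one G.2.2 fun e => !lookup e.2.2 (ψ e.1) (ψ e.2.1)
      zify
      rw [← this]
      simp [Function.comp_def]
  have h1 := hunsat ψ hψ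
  have h2 : (G.2.2.length : ℝ) + G.2.2.countP (fun e => !lookup e.2.2 (ψ e.1) (ψ e.2.1)) ≤
      (choices G).countP fun c => decide (x c ≠ 0) := by exact_mod_cast hcount
  linarith

/-- At every node of nonzero weight the gap of the base system multiplies the number of nonzero
children. -/
theorem pow_le_countP_tuples (hs : 0 < G.2.1) (hε : 0 ≤ ε)
    (hunsat : ∀ ψ : ℕ → ℕ, (∀ v, ψ v < G.2.1) →
      ε * G.2.2.length ≤ G.2.2.countP fun e => !lookup e.2.2 (ψ e.1) (ψ e.2.1))
    (X : Var → ℤ) (hX : X ([], []) ≠ 0) {r : ℕ}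
    (heq : ∀ π ∈ tuplesLT (choices G) r, ∀ q ∈ equations G,
      (q.1.map fun c => X (c :: π, [])).sum = X (π, q.2)) (j : ℕ) (hj : j ≤ r) :
    ((1 + ε) * G.2.2.length) ^ j ≤
      ((tuples (choices G) j).countP fun π => decide (X (π, []) ≠ 0) : ℕ) := by
  induction j with
  | zero => simp [tuples, hX]
  | succ j ih =>
    set K := (1 + ε) * G.2.2.length with hK
    have hK0 : 0 ≤ K := by positivity
    have h : ∀ l : List (List Choice), (∀ π ∈ l, π ∈ tuples (choices G) j) →
        K * (l.countP fun π => decide (X (π, []) ≠ 0) : ℕ) ≤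
          ((l.flatMap fun π => (choices G).map fun c => c :: π).countP
            fun π => decide (X (π, []) ≠ 0) : ℕ) := by
      intro l
      induction l with
      | nil => simp
      | cons π l ihl =>
        intro hl
        have h1 := ihl fun τ hτ => hl τ (List.mem_cons_of_mem _ hτ)
        rw [List.flatMap_cons, List.countP_append, List.countP_cons, List.countP_map]
        push_cast
        have h2 : K * (if decide (X (π, []) ≠ 0) = true then (1 : ℝ) else 0) ≤
            (choices G).countP ((fun π => decide (X (π, []) ≠ 0)) ∘ fun c => c :: π) := by
          by_cases hπ : X (π, []) = 0
          · simp [hπ]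
          · have hmem := mem_tuples.1 (hl π List.mem_cons_self)
            have := le_countP_choices hs hunsat (fun c => X (c :: π, [])) (fun o => X (π, o)) hπ
              (heq π (mem_tuplesLT.2 ⟨by omega, hmem.2⟩))
            simpa [hπ, Function.comp_def] using this
        rw [mul_add]
        linarith
    rw [pow_succ, mul_comm]
    exact (mul_le_mul_of_nonneg_left (ih (by omega)) hK0).trans (h _ fun _ h => h)

end Soundness

/-! ### From the constraint satisfaction problem to the closest vector problem -/

namespace TwoCSP

instance : Enc TwoCSP := ⟨TwoCSP.encode⟩

/-- The truth table of a constraint, row by row. -/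
def truthTable {s : ℕ} (R : Finset (Fin s × Fin s)) : List (List Bool) :=
  List.ofFn fun a : Fin s => List.ofFn fun b : Fin s => decide ((a, b) ∈ R)

/-- The edge with its constraint as a truth table. -/
def rawEdge {k s : ℕ} (e : Constraint k s) : Edge := (e.u, e.v, truthTable e.rel)

/-- The instance without the bounds and proofs, in a form with the same encoding. -/
def raw (Γ : TwoCSP) : RawCSP := (Γ.k, Γ.s, Γ.edges.map rawEdge)

theorem enc_raw (Γ : TwoCSP) : enc Γ.raw = enc Γ := by
  have h : ∀ {s : ℕ} (R : Finset (Fin s × Fin s)), enc (truthTable R) = encodeRel R := by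
    intro s R
    change Val.ofList (List.map (fun l => Val.ofList (List.map Val.ofBool l)) _) = _
    simp only [truthTable, encodeRel, List.map_ofFn, Function.comp_def]
  change Val.cons _ (Val.cons _ (Val.ofList (List.map enc (Γ.edges.map rawEdge)))) = Val.cons _ _
  rw [List.map_map]
  congr 3
  refine List.map_congr_left fun e _ => ?_
  change Val.cons _ (Val.cons _ (enc (truthTable e.rel))) = _
  rw [h]
  rfl

theorem lookup_truthTable {s : ℕ} (R : Finset (Fin s × Fin s)) (a b : Fin s) :
    lookup (truthTable R) a b = decide ((a, b) ∈ R) := by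
  simp [lookup, truthTable, List.getD_eq_getElem?_getD]

variable (Γ : TwoCSP)

theorem nodup_raw : Γ.raw.2.2.Nodup := by
  refine List.Nodup.of_map (fun e : Edge => (e.1, e.2.1)) ?_
  have h : (Γ.raw.2.2).map (fun e : Edge => (e.1, e.2.1)) =
      (Γ.edges.map fun e => (e.u, e.v)).map fun p => ((p.1 : ℕ), (p.2 : ℕ)) := by
    simp [raw, rawEdge, Function.comp_def]
  rw [h]
  refine Γ.nodup.map fun p q hpq => ?_
  simp only [Prod.mk.injEq] at hpq
  exact Prod.ext (Fin.ext hpq.1) (Fin.ext hpq.2)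

theorem endpoints_lt : ∀ e ∈ Γ.raw.2.2, e.1 < Γ.raw.1 ∧ e.2.1 < Γ.raw.1 := by
  intro e he
  obtain ⟨e, _, rfl⟩ := List.mem_map.1 he
  exact ⟨e.u.2, e.v.2⟩

theorem length_edges_le : Γ.edges.length ≤ Γ.k * Γ.k := by
  have := Γ.nodup.length_le_card
  simpa using this

theorem length_edges_pos : 0 < Γ.edges.length := List.length_pos_iff.2 Γ.edges_ne

theorem length_raw : Γ.raw.2.2.length = Γ.edges.length := List.length_map _

theorem exists_satisfying_of_value_eq_one (h : Γ.value = 1) : ∃ ψ : ℕ → ℕ,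
    (∀ v, ψ v < Γ.raw.2.1) ∧ ∀ e ∈ Γ.raw.2.2, lookup e.2.2 (ψ e.1) (ψ e.2.1) = true := by
  have : Nonempty (Fin Γ.k → Fin Γ.s) := ⟨fun _ => ⟨0, Γ.s_pos⟩⟩
  obtain ⟨ψ, hψ⟩ := exists_eq_ciSup_of_finite (f := Γ.assignmentValue)
  have hlen : (0 : ℝ) < Γ.edges.length := by exact_mod_cast Γ.length_edges_pos
  have h1 : Γ.assignmentValue ψ = 1 := hψ.trans h
  rw [assignmentValue, div_eq_one_iff_eq hlen.ne', Nat.cast_inj, List.countP_eq_length] at h1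
  refine ⟨fun v => if hv : v < Γ.k then ψ ⟨v, hv⟩ else 0, fun v => ?_, fun e he => ?_⟩
  · dsimp only
    split_ifs with hv
    · exact (ψ _).2
    · exact Γ.s_pos
  · obtain ⟨e, he', rfl⟩ := List.mem_map.1 he
    simpa [rawEdge, lookup_truthTable] using h1 e he'

theorem unsatisfied_of_value_lt {ε : ℝ} (h : Γ.value < 1 - ε) (ψ : ℕ → ℕ)
    (hψ : ∀ v, ψ v < Γ.raw.2.1) : ε * Γ.raw.2.2.length ≤
      Γ.raw.2.2.countP fun e => !lookup e.2.2 (ψ e.1) (ψ e.2.1) := by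
  have hlen : (0 : ℝ) < Γ.edges.length := by exact_mod_cast Γ.length_edges_pos
  let φ : Fin Γ.k → Fin Γ.s := fun v => ⟨ψ v, hψ v⟩
  have h1 : Γ.assignmentValue φ ≤ Γ.value := le_ciSup (Set.finite_range _).bddAbove φ
  have h2 := h1.trans_lt h
  rw [assignmentValue, div_lt_iff₀ hlen] at h2
  have h3 := List.length_eq_countP_add_countP (l := Γ.edges)
    (p := fun e => decide ((φ e.u, φ e.v) ∈ e.rel))
  have h4 : Γ.raw.2.2.countP (fun e => !lookup e.2.2 (ψ e.1) (ψ e.2.1)) =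
      Γ.edges.countP fun e => decide ¬(decide ((φ e.u, φ e.v) ∈ e.rel)) = true := by
    rw [raw, List.countP_map]
    refine List.countP_congr fun e _ => ?_
    have := lookup_truthTable e.rel (φ e.u) (φ e.v)
    simp only [φ] at this
    simp [rawEdge, this, φ]
  rw [h4, length_raw]
  have h5 : (Γ.edges.length : ℝ) = _ := congrArg Nat.cast h3
  push_cast at h5
  linarith

end TwoCSP

theorem ofFn_getElem_map {α β : Type*} (l : List α) (f : α → β) :
    (List.ofFn fun i : Fin l.length => f l[i]) = l.map f := by
  refine List.ext_getElem (by simp) fun i h1 h2 => ?_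
  simp

theorem sum_getElem {α β : Type*} [AddCommMonoid β] (l : List α) (f : α → β) :
    ∑ i : Fin l.length, f l[i] = (l.map f).sum := by
  rw [← ofFn_getElem_map, List.sum_ofFn]

theorem rows_ne_nil (Γ : TwoCSP) {r : ℕ} (hr : 0 < r) : rows Γ.raw r ≠ [] := by
  obtain ⟨e, he⟩ := List.exists_mem_of_length_pos (Γ.length_raw ▸ Γ.length_edges_pos)
  refine List.ne_nil_of_mem (List.mem_append_left _ (List.mem_flatMap.2 ⟨[], ?_,
    List.mem_map_of_mem (mem_equations.2 ⟨e, he, .inl rfl⟩)⟩))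
  exact mem_tuplesLT.2 ⟨hr, by simp⟩

theorem columns_ne_nil (Γ : TwoCSP) {r : ℕ} (hr : 0 < r) : columns Γ.raw r ≠ [] := by
  obtain ⟨e, he⟩ := List.exists_mem_of_length_pos (Γ.length_raw ▸ Γ.length_edges_pos)
  exact List.ne_nil_of_mem (mem_columns.2 (.inl ⟨[], mem_tuplesLT.2 ⟨hr, by simp⟩, e.1,
    (Γ.endpoints_lt e he).1, 0, Γ.s_pos, rfl⟩))

/-- The instance of the closest vector problem for the tree of depth `r`. -/
def latticeInstance (Γ : TwoCSP) {r : ℕ} (hr : 0 < r) (g : ℕ) : CVPInstance where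
  n := (rows Γ.raw r).length
  q := (columns Γ.raw r).length
  n_pos := List.length_pos_iff.2 (rows_ne_nil Γ hr)
  q_pos := List.length_pos_iff.2 (columns_ne_nil Γ hr)
  B := fun i j => entry (scale Γ.raw r g) (rows Γ.raw r)[i] (columns Γ.raw r)[j]
  y := fun i => target (scale Γ.raw r g) (rows Γ.raw r)[i]
  t := threshold Γ.raw r
  t_pos := pow_pos (Γ.length_raw ▸ Γ.length_edges_pos) r

theorem polyTime_encode_latticeInstance {r : ℕ} (hr : 0 < r) (g : ℕ) :
    PolyTime fun Γ : TwoCSP => (latticeInstance Γ hr g).encode := by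
  have hraw : PolyTime TwoCSP.raw := PolyTime.id.of_enc_eq TwoCSP.enc_raw
  refine ((PolyTime.lattice r g).comp hraw).of_enc_eq fun Γ => ?_
  change CVPInstance.encode _ = Val.cons (Val.ofList (List.map (fun l => Val.ofList
    (List.map Val.ofInt l)) _)) (Val.cons (Val.ofList (List.map Val.ofInt _)) (Val.binary _))
  rw [List.map_map, List.map_map, ← ofFn_getElem_map (rows Γ.raw r),
    ← ofFn_getElem_map (rows Γ.raw r)]
  simp only [Function.comp_def, List.map_map]
  simp only [← ofFn_getElem_map (columns Γ.raw r)]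
  rfl

theorem latticeInstance_apply (Γ : TwoCSP) {r : ℕ} (hr : 0 < r) (g : ℕ) (X : Var → ℤ)
    (i : Fin (latticeInstance Γ hr g).n) :
    ((latticeInstance Γ hr g).B.mulVec (fun j => X (columns Γ.raw r)[j]) -
      X ([], []) • (latticeInstance Γ hr g).y) i =
      rowValue Γ.raw r (scale Γ.raw r g) (rows Γ.raw r)[i] X := by
  rw [rowValue, ← sum_getElem]
  rfl

theorem lpNorm_rpow {n : ℕ} {p : ℝ} (hp : 1 ≤ p) (v : Fin n → ℤ) :
    lpNorm p v ^ p = ∑ i, |(v i : ℝ)| ^ p := by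
  have hp0 : 0 < p := by linarith
  have hpr : (ENNReal.ofReal p).toReal = p := ENNReal.toReal_ofReal hp0.le
  rw [lpNorm, PiLp.norm_eq_sum (by rw [hpr]; exact hp0), hpr, ← Real.rpow_mul, one_div,
    inv_mul_cancel₀ hp0.ne', Real.rpow_one]
  · simp [Real.norm_eq_abs]
  · positivity

/-- The `p`-th power of the distance, split into equations and weights of leaves. -/
theorem latticeInstance_lpNorm (Γ : TwoCSP) {r : ℕ} (hr : 0 < r) (g : ℕ) {p : ℝ} (hp : 1 ≤ p)
    (X : Var → ℤ) :
    lpNorm p ((latticeInstance Γ hr g).B.mulVec (fun j => X (columns Γ.raw r)[j]) -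
      X ([], []) • (latticeInstance Γ hr g).y) ^ p =
      (((tuplesLT (choices Γ.raw) r).flatMap fun π => (equations Γ.raw).map fun q =>
        equationRow π q).map fun ρ =>
          |(rowValue Γ.raw r (scale Γ.raw r g) ρ X : ℝ)| ^ p).sum +
      ((tuples (choices Γ.raw) r).map fun π => |(X (π, []) : ℝ)| ^ p).sum := by
  rw [lpNorm_rpow hp]
  simp_rw [latticeInstance_apply]
  refine (sum_getElem (rows Γ.raw r)
    fun ρ => |(rowValue Γ.raw r (scale Γ.raw r g) ρ X : ℝ)| ^ p).trans ?_
  rw [rows, List.map_append, List.sum_append, List.map_map (g := _) (f := weightRow)]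
  congr 2
  refine List.map_congr_left fun π hπ => ?_
  rw [Function.comp_apply, rowValue_weightRow Γ.nodup_raw hr _ hπ]

theorem latticeInstance_yes (Γ : TwoCSP) {r : ℕ} (hr : 0 < r) (g : ℕ) {γ p : ℝ} (hγ : 1 ≤ γ)
    (hp : 1 ≤ p) (h : Γ.value = 1) : latticeInstance Γ hr g ∈ (gapCVP γ p hγ).yes := by
  obtain ⟨ψ, hψ, hsat⟩ := Γ.exists_satisfying_of_value_eq_one h
  have hp0 : p ≠ 0 := by linarith
  have hroot : assignmentWeight ψ ([], []) = 1 := rfl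
  have h01 : ∀ d, assignmentWeight ψ d = 0 ∨ assignmentWeight ψ d = 1 := fun d => by
    rw [assignmentWeight]; split_ifs <;> simp
  have heq : ∀ ρ ∈ ((tuplesLT (choices Γ.raw) r).flatMap fun π =>
      (equations Γ.raw).map fun q => equationRow π q),
      rowValue Γ.raw r (scale Γ.raw r g) ρ (assignmentWeight ψ) = 0 := by
    intro ρ hρ
    obtain ⟨π, hπ, hρ⟩ := List.mem_flatMap.1 hρ
    obtain ⟨q, hq, rfl⟩ := List.mem_map.1 hρ
    rw [rowValue_equationRow Γ.nodup_raw Γ.endpoints_lt _ hπ hq,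
      assignmentWeight_equation hψ hsat π hq, sub_self, mul_zero]
  refine ⟨fun j => assignmentWeight ψ (columns Γ.raw r)[j], fun i => ?_, ?_⟩
  · have := latticeInstance_apply Γ hr g (assignmentWeight ψ) i
    rw [hroot, one_smul] at this
    rw [this]
    have hi : (rows Γ.raw r)[i] ∈ rows Γ.raw r := List.getElem_mem _
    rcases List.mem_append.1 hi with hi | hi
    · rw [heq _ hi]; simp
    · obtain ⟨π, hπ, hi⟩ := List.mem_map.1 hi
      rw [← hi, rowValue_weightRow Γ.nodup_raw hr _ hπ]
      exact h01 _
  · have := latticeInstance_lpNorm Γ hr g hp (assignmentWeight ψ)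
    rw [hroot, one_smul] at this
    rw [this, List.sum_eq_zero, zero_add]
    · have hc := countP_agrees_tuples hψ hsat r
      have hs := sum_map_ite_one (tuples (choices Γ.raw) r) fun π => π.all (agrees ψ)
      rw [hc] at hs
      have hs' : ((tuples (choices Γ.raw) r).map fun π =>
          |(assignmentWeight ψ (π, []) : ℝ)| ^ p).sum = ((threshold Γ.raw r : ℤ) : ℝ) := by
        rw [threshold, ← hs, Int.cast_list_sum, List.map_map]
        refine congrArg List.sum (List.map_congr_left fun π _ => ?_)
        by_cases hπ : π.all (agrees ψ) = true <;> simp [assignmentWeight, hπ, hp0]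
      rw [hs']
      exact le_of_eq (Int.cast_natCast _)
    · intro z hz
      obtain ⟨ρ, hρ, rfl⟩ := List.mem_map.1 hz
      rw [heq ρ hρ, Int.cast_zero, abs_zero, Real.zero_rpow hp0]

theorem latticeInstance_no (Γ : TwoCSP) {r : ℕ} (hr : 0 < r) {g : ℕ} {ε γ p : ℝ} (hε : 0 ≤ ε)
    (hγ : 1 ≤ γ) (hp : 1 ≤ p) (hr' : γ < (1 + ε) ^ r) (hg : γ < 2 ^ g) (h : Γ.value < 1 - ε) :
    latticeInstance Γ hr g ∈ (gapCVP γ p hγ).no := by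
  intro x w hw
  have hnd := nodup_columns Γ.nodup_raw r
  -- the coefficients as weights, with the multiplier of the target as the weight of the root
  obtain ⟨X, hX, rfl⟩ : ∃ X : Var → ℤ, X ([], []) = w ∧ (fun j => X (columns Γ.raw r)[j]) = x := by
    have hinj : Function.Injective fun j : Fin (columns Γ.raw r).length =>
        (columns Γ.raw r)[j] := fun i j hij => Fin.ext (hnd.getElem_inj_iff.1 hij)
    refine ⟨Function.extend (fun j : Fin (columns Γ.raw r).length => (columns Γ.raw r)[j]) x
      fun _ => w, Function.extend_apply' _ _ _ ?_, funext fun j => hinj.extend_apply _ _ j⟩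
    rintro ⟨j, hj⟩
    have hmem : (([], []) : Var) ∈ columns Γ.raw r := hj ▸ List.getElem_mem _
    rcases mem_columns.1 hmem with ⟨_, _, _, _, _, _, h⟩ | ⟨_, _, _, _, h⟩ <;> simp at h
  subst hX
  rw [latticeInstance_lpNorm Γ hr g hp X]
  by_contra! hle
  change _ ≤ γ * (threshold Γ.raw r : ℝ) at hle
  set m := Γ.raw.2.2.length with hm
  have hm0 : 0 < m := by
    rw [hm, Γ.length_raw]
    exact Γ.length_edges_pos
  have hE0 : ∀ z ∈ (((tuplesLT (choices Γ.raw) r).flatMap fun π => (equations Γ.raw).map fun q =>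
        equationRow π q).map fun ρ =>
          |(rowValue Γ.raw r (scale Γ.raw r g) ρ X : ℝ)| ^ p), 0 ≤ z := by
    intro z hz
    obtain ⟨ρ, _, rfl⟩ := List.mem_map.1 hz
    positivity
  have hW0 : ∀ z ∈ ((tuples (choices Γ.raw) r).map fun π => |(X (π, []) : ℝ)| ^ p), 0 ≤ z := by
    intro z hz
    obtain ⟨ρ, _, rfl⟩ := List.mem_map.1 hz
    positivity
  have hone : ∀ z : ℤ, z ≠ 0 → |(z : ℝ)| ≤ |(z : ℝ)| ^ p := fun z hz => by
    have h1 : (1 : ℝ) ≤ |(z : ℝ)| := by exact_mod_cast Int.one_le_abs hz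
    simpa using Real.rpow_le_rpow_of_exponent_le h1 hp
  have hM : γ * (threshold Γ.raw r : ℝ) < (scale Γ.raw r g : ℝ) := by
    have h1 : (threshold Γ.raw r : ℝ) < 2 ^ threshold Γ.raw r := by
      exact_mod_cast Nat.lt_two_pow_self
    rw [scale, pow_add]
    push_cast
    have : (0 : ℝ) ≤ threshold Γ.raw r := Nat.cast_nonneg _
    nlinarith
  have heq : ∀ π ∈ tuplesLT (choices Γ.raw) r, ∀ q ∈ equations Γ.raw,
      (q.1.map fun c => X (c :: π, [])).sum = X (π, q.2) := by
    intro π hπ q hq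
    by_contra hne
    have hD := sub_ne_zero.2 hne
    have hrow := rowValue_equationRow Γ.nodup_raw Γ.endpoints_lt (scale Γ.raw r g) hπ hq X
    have hs0 : 0 < scale Γ.raw r g := by rw [scale]; positivity
    have hval : rowValue Γ.raw r (scale Γ.raw r g) (equationRow π q) X ≠ 0 := by
      rw [hrow]
      exact mul_ne_zero (by exact_mod_cast hs0.ne') hD
    have h1 : (scale Γ.raw r g : ℝ) ≤
        |(rowValue Γ.raw r (scale Γ.raw r g) (equationRow π q) X : ℝ)| := by
      rw [hrow, Int.cast_mul, abs_mul, Int.cast_natCast, Nat.abs_cast]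
      exact le_mul_of_one_le_right (Nat.cast_nonneg _) (by exact_mod_cast Int.one_le_abs hD)
    have h2 := List.single_le_sum hE0 _ (List.mem_map_of_mem (List.mem_flatMap.2
      ⟨π, hπ, List.mem_map_of_mem hq⟩))
    have h3 := List.sum_nonneg hW0
    linarith [hone _ hval]
  have hcount := pow_le_countP_tuples Γ.s_pos hε (Γ.unsatisfied_of_value_lt h) X hw heq r le_rfl
  have hsum : ((tuples (choices Γ.raw) r).countP (fun π => decide (X (π, []) ≠ 0)) : ℝ) ≤
      ((tuples (choices Γ.raw) r).map fun π => |(X (π, []) : ℝ)| ^ p).sum := by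
    have := sum_map_ite_one (tuples (choices Γ.raw) r) fun π => decide (X (π, []) ≠ 0)
    rw [← Int.cast_natCast (R := ℝ), ← this, Int.cast_list_sum, List.map_map]
    refine List.sum_le_sum fun π _ => ?_
    by_cases hπ : X (π, []) = 0
    · simp only [Function.comp_apply, hπ]
      simp
      positivity
    · refine le_trans ?_ (hone _ hπ)
      simp only [Function.comp_apply, ne_eq, hπ, not_false_eq_true, decide_true, if_true]
      exact_mod_cast Int.one_le_abs hπ
  have h1 := List.sum_nonneg hE0
  have h2 : γ * (threshold Γ.raw r : ℝ) < ((1 + ε) * m) ^ r := by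
    rw [threshold, mul_pow, ← hm]
    push_cast
    exact mul_lt_mul_of_pos_right hr' (by positivity)
  linarith

/-! ### Transfer of algorithms -/

instance : MeasureTheory.IsProbabilityMeasure coinTosses := by
  rw [coinTosses]
  infer_instance

theorem IsFPTAlgorithm.isRandomizedFPTAlgorithm {A : PromiseProblem} {P : Prog}
    (h : IsFPTAlgorithm A P) : IsRandomizedFPTAlgorithm A P where
  time := h.time
  yes I hI := by
    rw [show {ω | Outputs P ω (A.encode I) (Val.ofBool true)} = Set.univ from
      Set.eq_univ_of_forall (h.yes I hI), MeasureTheory.probReal_univ]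
    norm_num
  no I hI := by
    rw [show {ω | Outputs P ω (A.encode I) (Val.ofBool false)} = Set.univ from
      Set.eq_univ_of_forall (h.no I hI), MeasureTheory.probReal_univ]
    norm_num

theorem computable_pow (n : ℕ) : Computable fun k : ℕ => k ^ n := by
  induction n with
  | zero => simpa using Computable.const 1
  | succ n ih =>
    simp only [pow_succ]
    exact Primrec.nat_mul.to_comp.comp ih Computable.id

theorem computable_sum_range {f : ℕ → ℕ} (hf : Computable f) :
    Computable fun n => ∑ i ∈ Finset.range n, f i := by
  have h : Computable fun n : ℕ =>
      (Nat.rec 0 (fun i s => s + f i) n : ℕ) :=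
    Computable.nat_rec Computable.id (Computable.const 0)
      ((Primrec.nat_add.to_comp.comp (Computable.snd.comp Computable.snd)
        (hf.comp (Computable.fst.comp Computable.snd))).to₂)
  refine h.of_eq fun n => ?_
  induction n with
  | zero => rfl
  | succ n ih => rw [Finset.sum_range_succ, ← ih]

/-- An FPT reduction: a polynomial-time map on encodings that preserves YES and NO instances and
bounds the new parameter by a power of the old one. -/
theorem exists_isRandomizedFPTAlgorithm_of_reduction {A B : PromiseProblem} [Enc A.Inst]
    (henc : ∀ I : A.Inst, enc I = A.encode I) (ρ : A.Inst → B.Inst)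
    (hρ : PolyTime fun I => B.encode (ρ I)) {n : ℕ} (hparam : ∀ I, B.param (ρ I) ≤ A.param I ^ n)
    (hyes : ∀ I ∈ A.yes, ρ I ∈ B.yes) (hno : ∀ I ∈ A.no, ρ I ∈ B.no) {P : Prog}
    (hP : IsRandomizedFPTAlgorithm B P) : ∃ Q, IsRandomizedFPTAlgorithm A Q := by
  obtain ⟨R, T, ⟨c, hT⟩, ⟨d, hs⟩, hR⟩ := hρ
  obtain ⟨f, e, hf, htime⟩ := hP.time
  have hout : ∀ I v, {ω | Outputs P ω (B.encode (ρ I)) v} ⊆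
      {ω | Outputs (.seq R P) ω (A.encode I) v} := by
    rintro I v ω ⟨j, t, h⟩
    have := hR I ω 0
    rw [henc] at this
    exact ⟨j, _, this.seq h⟩
  refine ⟨.seq R P, ⟨?_, fun I hI => ?_, fun I hI => ?_⟩⟩
  · refine ⟨fun k => 3 ^ (c + d * e) * (2 + ∑ i ∈ Finset.range (k ^ n + 1), f i), c + d * e, ?_,
      fun I ω => ?_⟩
    · exact Primrec.nat_mul.to_comp.comp (Computable.const _) (Primrec.nat_add.to_comp.comp
        (Computable.const 2) ((computable_sum_range hf).comp
          (Computable.succ.comp (computable_pow n))))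
    · obtain ⟨y, j, t, hexec, ht⟩ := htime (ρ I) ω
      have h1 := hR I ω 0
      rw [henc] at h1
      refine ⟨y, j, _, h1.seq hexec, ?_⟩
      set F := ∑ i ∈ Finset.range (A.param I ^ n + 1), f i with hF
      have hfF : f (B.param (ρ I)) ≤ F :=
        Finset.single_le_sum (f := f) (fun _ _ => Nat.zero_le _)
          (Finset.mem_range.2 (Nat.lt_succ_of_le (hparam I)))
      set N := sz I + 2 with hN
      have hN1 : 1 ≤ N := by omega
      have hNs : N ≤ 3 * (A.encode I).size := by
        have h2 : sz I = (A.encode I).size := by rw [sz, henc]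
        have := (A.encode I).one_le_size
        omega
      have hT' : T I ≤ N ^ (c + d * e) := (hT I).trans (Nat.pow_le_pow_right hN1 (by omega))
      have ht' : t ≤ F * N ^ (c + d * e) := by
        refine ht.trans (Nat.mul_le_mul hfF ?_)
        calc (B.encode (ρ I)).size ^ e ≤ (N ^ d) ^ e := Nat.pow_le_pow_left (hs I) e
          _ = N ^ (d * e) := (pow_mul _ _ _).symm
          _ ≤ N ^ (c + d * e) := Nat.pow_le_pow_right hN1 (by omega)
      have hpos : 1 ≤ N ^ (c + d * e) := Nat.one_le_pow _ _ hN1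
      calc T I + t + 1 ≤ (2 + F) * N ^ (c + d * e) := by linarith
        _ ≤ (2 + F) * (3 * (A.encode I).size) ^ (c + d * e) :=
          Nat.mul_le_mul_left _ (Nat.pow_le_pow_left hNs _)
        _ = _ := by rw [mul_pow]; ring
  · exact (hP.yes _ (hyes I hI)).trans (MeasureTheory.measureReal_mono (hout I _))
  · exact (hP.no _ (hno I hI)).trans (MeasureTheory.measureReal_mono (hout I _))

/-- The depth `r` of the tree makes the gap `(1 + ε) ^ r` larger than `γ`. -/
theorem PIH.not_isRandomizedFPTAlgorithm_gapCVP (hPIH : PIH) {γ p : ℝ} (hγ : 1 ≤ γ) (hp : 1 ≤ p)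
    (P : Prog) : ¬ IsRandomizedFPTAlgorithm (gapCVP γ p hγ) P := by
  intro hP
  obtain ⟨ε, hε, hno⟩ := hPIH
  obtain ⟨r, hr⟩ := pow_unbounded_of_one_lt γ (show 1 < 1 + ε by linarith)
  obtain ⟨g, hg⟩ := pow_unbounded_of_one_lt γ (one_lt_two (α := ℝ))
  have hr0 : 0 < r := Nat.pos_of_ne_zero fun h => by
    rw [h, pow_zero] at hr
    linarith
  let _ : Enc (gapTwoCSP ε hε.le).Inst := inferInstanceAs (Enc TwoCSP)
  refine hno (exists_isRandomizedFPTAlgorithm_of_reduction (A := gapTwoCSP ε hε.le)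
    (B := gapCVP γ p hγ) (n := 2 * r) (fun _ => rfl) (fun Γ => latticeInstance Γ hr0 g)
    (polyTime_encode_latticeInstance hr0 g) (fun Γ => ?_)
    (fun Γ hΓ => latticeInstance_yes Γ hr0 g hγ hp hΓ)
    (fun Γ hΓ => latticeInstance_no Γ hr0 hε.le hγ hp hr hg hΓ) hP)
  change Γ.raw.2.2.length ^ r ≤ Γ.k ^ (2 * r)
  rw [Γ.length_raw, pow_mul, pow_two]
  exact Nat.pow_le_pow_left Γ.length_edges_le r

end ParamComplexity

open ParamComplexity in
theorem theorem6p3 (hPIH : PIH) (γ p : ℝ) (hγ : 1 ≤ γ) (hp : 1 ≤ p) :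
    (¬ ∃ P : Prog, IsFPTAlgorithm (gapCVP γ p hγ) P) ∧
      ¬ ∃ P : Prog, IsRandomizedFPTAlgorithm (gapCVP γ p hγ) P :=
  ⟨fun ⟨P, hP⟩ => hPIH.not_isRandomizedFPTAlgorithm_gapCVP hγ hp P hP.isRandomizedFPTAlgorithm,
    fun ⟨P, hP⟩ => hPIH.not_isRandomizedFPTAlgorithm_gapCVP hγ hp P hP⟩
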